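/- Let $0<\alpha<1/2$, $r=n^\alpha$, and let $G$ be the random geometric graph whose vertices are $n$ independent uniformly random points of the square $[0,\sqrt n]^2$, two distinct vertices being adjacent when their Euclidean distance is less than $r$. Let $d_G$ be the graph distance ($+\infty$ between different components) and $N(v)$ the set of neighbours of $v$. A vertex $v$ is called deep if at least $11r^2$ vertices (including $v$) are at graph distance at most $2$ from $v$. For $0\le t\le 2r$ let $F(t)$ be the area of the lune $B((t,0),r)\setminus B((0,0),r)$ in the plane, so that $F$ is an increasing bijection from $[0,2r]$ to $[0,\pi r^2]$. For a deep vertex $v$ and a vertex $w$ with $d_G(w,v)\le 2$ define $$\tilde d(w,v)=\begin{cases}F^{-1}\big(\min\{|N(v)\setminus N(w)|,\,F(r)\}\big) & \text{if } d_G(w,v)\le 1,\\ F^{-1}\big(\max\{F(r),\,\pi r^2-|N(v)\cap N(w)|\}\big) & \text{if } d_G(w,v)=2,\end{cases}$$ and for any vertex $u$ and any deep vertex $v$ let $$\widehat d(u,v)=\min_{w:\,d_G(w,v)\le 2}\Big(r\,d_G(u,w)+\tilde d(w,v)+100\sqrt{\log n}\Big).$$ There is an absolute constant $C'>0$ (independent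 of $\alpha$) such that, for every constant $0<\alpha<1/2$, with probability tending to $1$ as $n\to\infty$, all vertices $u$ and all deep vertices $v$ satisfy $$\|u-v\|\le \widehat d(u,v)\le \|u-v\|+\widehat\varepsilon,\qquad \widehat\varepsilon= C'\begin{cases} n^{\frac12-\frac43\alpha} & \text{if }\alpha<3/8,\\ \sqrt{\log n} & \text{if }3/8\le\alpha<1/2.\end{cases}$$ -/

import Mathlib

open MeasureTheory Filter Topology
open scoped ENNReal

noncomputable section

/-- The Euclidean plane. -/
abbrev Plane : Type := EuclideanSpace ℝ (Fin 2)

/-- The square `[0, √n]²`, of area `n`. -/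
def square (n : ℕ) : Set Plane := {p | ∀ i, p i ∈ Set.Icc (0 : ℝ) (Real.sqrt n)}

/-- The law of `n` independent points, each uniform in the square `[0, √n]²`. -/
def pointsLaw (n : ℕ) : Measure (Fin n → Plane) :=
  Measure.pi fun _ => ProbabilityTheory.cond volume (square n)

/-- The geometric graph on the points `x`: two distinct vertices are adjacent when
their Euclidean distance is less than `r`. -/
def geomGraph {n : ℕ} (r : ℝ) (x : Fin n → Plane) : SimpleGraph (Fin n) where
  Adj u v := u ≠ v ∧ dist (x u) (x v) < r
  symm := ⟨fun u v h => ⟨h.1.symm, by rw [dist_comm]; exact h.2⟩⟩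
  loopless := ⟨fun _ h => h.1 rfl⟩

/-- A vertex is deep when at least `11 r²` vertices (itself included) are at graph
distance at most `2` from it. The graph distance is `∞` between different components. -/
def IsDeep {V : Type*} (G : SimpleGraph V) (r : ℝ) (v : V) : Prop :=
  11 * r ^ 2 ≤ (({w : V | G.edist v w ≤ 2}.ncard : ℕ) : ℝ)

/-- `F(t)`: the area of the lune `B((t,0), r) \ B((0,0), r)`. -/
def luneArea (r t : ℝ) : ℝ :=
  volume.real (Metric.ball (!₂[t, 0] : Plane) r \ Metric.ball (!₂[0, 0] : Plane) r)

/-- `F⁻¹(y)`: the inverse of the increasing bijection `F : [0, 2r] → [0, π r²]`. -/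
def luneAreaInv (r y : ℝ) : ℝ := Function.invFunOn (luneArea r) (Set.Icc 0 (2 * r)) y

/-- The short-range estimate of `‖v - w‖`, for a deep vertex `v` and a vertex `w` at graph
distance at most `2` from it: through the number of neighbours of the deep vertex that are not
neighbours of `w` when the graph distance is at most `1`, and through the number of common
neighbours when it is `2`. -/
def shortDist {V : Type*} (G : SimpleGraph V) (r : ℝ) (v w : V) : ℝ :=
  if G.edist v w ≤ 1 then
    luneAreaInv r (min ((G.neighborSet v \ G.neighborSet w).ncard : ℝ) (luneArea r r))
  else
    luneAreaInv r
      (max (luneArea r r) (Real.pi * r ^ 2 - ((G.neighborSet v ∩ G.neighborSet w).ncard : ℝ)))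

/-- The hybrid estimate of `‖u - v‖`, for a deep vertex `v`: the minimum of
`r d_G(u,w) + shortDist(w,v) + c` over the vertices `w` with `d_G(w,v) ≤ 2`.
It is `∞` when no such `w` is in the component of `u`. -/
def hybridDist {V : Type*} (G : SimpleGraph V) (r c : ℝ) (u v : V) : ℝ≥0∞ :=
  ⨅ (w : V) (_ : G.edist w v ≤ 2),
    ENNReal.ofReal r * (G.edist u w : ℝ≥0∞) + ENNReal.ofReal (shortDist G r v w + c)

/-- The order of the error: `n^(1/2 - 4α/3)` for `α < 3/8` and `√(log n)` for `α ≥ 3/8`. -/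
def errorRate (α : ℝ) (n : ℕ) : ℝ :=
  if α < 3 / 8 then (n : ℝ) ^ (1 / 2 - 4 / 3 * α) else Real.sqrt (Real.log n)

end

/-! Lower bound. Every edge is shorter than `r`, so `r` times the graph distance from `u` to `w` is
at least the Euclidean distance (`ofReal_dist_le_edist`). The term `100 √(log n)` covers the error
of `shortDist` (`abs_shortDist_sub_dist_le`), and the triangle inequality through `w` does the rest.

Short range. A disc of radius `2r` has area `4πr² > 12.5 r²`, but at most `10.8 r²` of it lies in
the square when its centre is within `r` of a side. A deep vertex is therefore farther than `r` from
every side (`IsDeep.mem_interior`), and the lunes and lenses in its `r`-disc lie in the square.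
Chernoff's bound and a union bound over pairs make all counts equal to the areas up to `deviation`.
The slope of `luneArea r` at `t` is `√(4r² - t²)`, the length of the common chord. Up to `t = r` it
is of order `r`, so a count error of order `r √(log n)` costs `√(log n)` in distance. Near `2r` the
slope degenerates, but the lens shrinks, and with it the fluctuation of the number of common
neighbours; the quotient is again of order `√(log n)`.

Upper bound. If `u` and `v` are adjacent or equal, take `w = u`. Otherwise cut the strip of
half-width `h` around the segment into cells of length `l` with `h l = 4`, and walk greedily from
`u`, each hop going to the farthest occupied cell within `m ≈ r / l` cells. A hop loses `O(l)` to
the discretisation and `O(h²/r)` to the lateral displacement; these balance at `h = r^(1/3)`, where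
both are of order `1/h`. The empty cells met at the ends of the hops have exponential tails, so `k`
hops lose at most `k + O(log n)` cells to them (`measureReal_gapChain_le`). About `√n / r` hops thus
lose `√n / r^(4/3)` plus a term `O(log n / h)`, which tends to `0`. The walk is left at a vertex `w`
two hops before `v`, and `shortDist` replaces the rest, so no rounding error of order `r` appears
(`exists_path`). -/

/-! ### The area of a lune as a function of the distance of the centres. -/

/-- Cartesian coordinates preserve area. -/
theorem measurePreserving_coords :
    MeasurePreserving (fun p : Plane => (p 0, p 1)) volume volume :=
  (volume_preserving_finTwoArrow ℝ).comp (PiLp.volume_preserving_ofLp (Fin 2))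

theorem dist_sq_coords (p q : Plane) :
    dist p q ^ 2 = (p 0 - q 0) ^ 2 + (p 1 - q 1) ^ 2 := by
  rw [EuclideanSpace.dist_eq, Real.sq_sqrt (by positivity), Fin.sum_univ_two]
  simp [Real.dist_eq, sq_abs]

theorem dist_lt_iff_coords (p q : Plane) {r : ℝ} (hr : 0 < r) :
    dist p q < r ↔ (p 0 - q 0) ^ 2 + (p 1 - q 1) ^ 2 < r ^ 2 := by
  rw [← dist_sq_coords, sq_lt_sq₀ dist_nonneg hr.le]

/-- The length of a horizontal slice of the lune. -/
noncomputable def luneSlice (r t y : ℝ) : ℝ := min t (2 * Real.sqrt (r ^ 2 - y ^ 2))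

theorem volume_luneSlice {r t : ℝ} (ht : 0 ≤ t) (y : ℝ) :
    volume {x : ℝ | (x - t) ^ 2 + y ^ 2 < r ^ 2 ∧ ¬ x ^ 2 + y ^ 2 < r ^ 2} =
      ENNReal.ofReal (luneSlice r t y) := by
  unfold luneSlice
  set c := Real.sqrt (r ^ 2 - y ^ 2) with hc
  have hc0 : 0 ≤ c := Real.sqrt_nonneg _
  have key : ∀ z : ℝ, z ^ 2 + y ^ 2 < r ^ 2 ↔ |z| < c := by
    intro z
    rw [hc, Real.lt_sqrt (abs_nonneg z), sq_abs]
    constructor <;> intro h <;> linarith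
  simp only [key, abs_lt, not_and_or, not_lt]
  rcases le_total t (2 * c) with h | h
  · rw [min_eq_left h]
    -- Removing `t - c` matters only when `t = 2c`: then it is the point `c`, which the open disc
    -- around `(t, 0)` misses.
    have : {x : ℝ | (-c < x - t ∧ x - t < c) ∧ (x ≤ -c ∨ c ≤ x)} = Set.Ico c (t + c) \ {t - c} := by
      ext x
      simp only [Set.mem_ofPred_eq, Set.mem_sdiff, Set.mem_Ico, Set.mem_singleton_iff]
      constructor
      · rintro ⟨⟨h1, h2⟩, h3 | h3⟩
        · exfalso; linarith
        · exact ⟨⟨h3, by linarith⟩, fun h4 => by linarith⟩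
      · rintro ⟨⟨h1, h2⟩, h3⟩
        refine ⟨⟨?_, by linarith⟩, Or.inr h1⟩
        rcases lt_or_eq_of_le (show t - c ≤ x by linarith) with h4 | h4
        · linarith
        · exact absurd h4.symm h3
    rw [this, measure_sdiff_null (by simp), Real.volume_Ico]
    congr 1; ring
  · rw [min_eq_right h]
    have : {x : ℝ | (-c < x - t ∧ x - t < c) ∧ (x ≤ -c ∨ c ≤ x)} = Set.Ioo (t - c) (t + c) := by
      ext x
      simp only [Set.mem_ofPred_eq, Set.mem_Ioo]
      constructor
      · rintro ⟨⟨h1, h2⟩, -⟩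
        exact ⟨by linarith, by linarith⟩
      · rintro ⟨h1, h2⟩
        exact ⟨⟨by linarith, by linarith⟩, Or.inr (by linarith)⟩
    rw [this, Real.volume_Ioo]
    congr 1; ring

theorem luneSlice_nonneg {r t : ℝ} (ht : 0 ≤ t) (y : ℝ) : 0 ≤ luneSlice r t y :=
  le_min ht (by positivity)

theorem continuous_luneSlice (r t : ℝ) : Continuous (luneSlice r t) := by
  unfold luneSlice; fun_prop

theorem volume_lune {r t : ℝ} (hr : 0 < r) (ht : 0 ≤ t) :
    volume (Metric.ball (!₂[t, 0] : Plane) r \ Metric.ball (!₂[0, 0] : Plane) r) =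
      ∫⁻ y, ENNReal.ofReal (luneSlice r t y) := by
  set S : Set (ℝ × ℝ) :=
    {z | (z.1 - t) ^ 2 + z.2 ^ 2 < r ^ 2 ∧ ¬ z.1 ^ 2 + z.2 ^ 2 < r ^ 2} with hS
  have hSm : MeasurableSet S := by
    apply MeasurableSet.inter
    · exact measurableSet_lt (f := fun z : ℝ × ℝ => (z.1 - t) ^ 2 + z.2 ^ 2)
        (g := fun _ => r ^ 2) (by fun_prop) (by fun_prop)
    · exact (measurableSet_lt (f := fun z : ℝ × ℝ => z.1 ^ 2 + z.2 ^ 2)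
        (g := fun _ => r ^ 2) (by fun_prop) (by fun_prop)).compl
  have h1 : Metric.ball (!₂[t, 0] : Plane) r \ Metric.ball (!₂[0, 0] : Plane) r =
      (fun p : Plane => (p 0, p 1)) ⁻¹' S := by
    ext p
    simp only [Set.mem_sdiff, Metric.mem_ball, dist_lt_iff_coords _ _ hr, hS, Set.mem_preimage,
      Set.mem_ofPred_eq]
    simp
  rw [h1, measurePreserving_coords.measure_preimage hSm.nullMeasurableSet, Measure.volume_eq_prod,
    Measure.prod_apply_symm hSm]
  refine lintegral_congr fun y => ?_
  rw [← volume_luneSlice ht y]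
  rfl

theorem luneSlice_eq_zero {r t y : ℝ} (hr : 0 < r) (ht : 0 ≤ t) (hy : r < |y|) :
    luneSlice r t y = 0 := by
  unfold luneSlice
  rw [Real.sqrt_eq_zero_of_nonpos, mul_zero, min_eq_right ht]
  nlinarith [sq_abs y]

theorem integrable_luneSlice {r t : ℝ} (hr : 0 < r) (ht : 0 ≤ t) :
    Integrable (luneSlice r t) := by
  apply (continuous_luneSlice r t).integrable_of_hasCompactSupport
  refine HasCompactSupport.of_support_subset_isCompact (isCompact_Icc (a := -r) (b := r)) ?_
  intro y hy
  rw [Set.mem_Icc, ← abs_le]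
  by_contra h
  exact hy (luneSlice_eq_zero hr ht (not_le.mp h))

theorem luneArea_eq {r t : ℝ} (hr : 0 < r) (ht : 0 ≤ t) :
    luneArea r t = ∫ y, luneSlice r t y := by
  rw [luneArea, measureReal_def, volume_lune hr ht, integral_eq_lintegral_of_nonneg_ae
    (ae_of_all _ (luneSlice_nonneg ht)) (continuous_luneSlice r t).aestronglyMeasurable]

/-- At heights up to half the common chord for distance `t`, the slices have lengths exactly `s` and
`t`; elsewhere they can only grow with the distance. -/
theorem luneArea_sub_ge {r s t : ℝ} (hr : 0 < r) (hs : 0 ≤ s) (hst : s ≤ t) (ht : t ≤ 2 * r) :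
    (t - s) * Real.sqrt (4 * r ^ 2 - t ^ 2) ≤ luneArea r t - luneArea r s := by
  rw [luneArea_eq hr hs, luneArea_eq hr (hs.trans hst),
    ← integral_sub (integrable_luneSlice hr (hs.trans hst)) (integrable_luneSlice hr hs)]
  set ρ := Real.sqrt (4 * r ^ 2 - t ^ 2) / 2 with hρ
  have hρ0 : 0 ≤ ρ := by positivity
  have hρ2 : ρ ^ 2 = r ^ 2 - t ^ 2 / 4 := by
    rw [hρ, div_pow, Real.sq_sqrt (by nlinarith)]; ring
  have h1 : (t - s) * Real.sqrt (4 * r ^ 2 - t ^ 2) =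
      ∫ y, (Set.Icc (-ρ) ρ).indicator (fun _ => t - s) y := by
    rw [integral_indicator measurableSet_Icc, setIntegral_const, measureReal_def, Real.volume_Icc,
      ENNReal.toReal_ofReal (by linarith), smul_eq_mul, hρ]
    ring
  rw [h1]
  apply integral_mono
  · exact (integrable_indicator_iff measurableSet_Icc).2 (by simp)
  · exact (integrable_luneSlice hr (hs.trans hst)).sub (integrable_luneSlice hr hs)
  intro y
  by_cases hy : y ∈ Set.Icc (-ρ) ρ
  · rw [Set.indicator_of_mem hy]
    have hy2 : y ^ 2 ≤ ρ ^ 2 := sq_le_sq' hy.1 hy.2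
    have : t ≤ 2 * Real.sqrt (r ^ 2 - y ^ 2) := by
      have : t / 2 ≤ Real.sqrt (r ^ 2 - y ^ 2) := by
        apply Real.le_sqrt_of_sq_le
        nlinarith
      linarith
    simp only [luneSlice]
    rw [min_eq_left this, min_eq_left (hst.trans this)]
  · rw [Set.indicator_of_notMem hy]
    simp only [luneSlice, sub_nonneg]
    exact min_le_min_right _ hst

/-- Outside the common chord for distance `s` the slice is already a full slice of the disc, so only
heights within that chord contribute, each by at most `t - s`. -/
theorem luneArea_sub_le {r s t : ℝ} (hr : 0 < r) (hs : 0 ≤ s) (hst : s ≤ t) (ht : t ≤ 2 * r) :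
    luneArea r t - luneArea r s ≤ (t - s) * Real.sqrt (4 * r ^ 2 - s ^ 2) := by
  rw [luneArea_eq hr hs, luneArea_eq hr (hs.trans hst),
    ← integral_sub (integrable_luneSlice hr (hs.trans hst)) (integrable_luneSlice hr hs)]
  set ρ := Real.sqrt (4 * r ^ 2 - s ^ 2) / 2 with hρ
  have hρ0 : 0 ≤ ρ := by positivity
  have hρ2 : ρ ^ 2 = r ^ 2 - s ^ 2 / 4 := by
    rw [hρ, div_pow, Real.sq_sqrt (by nlinarith)]; ring
  have h1 : (t - s) * Real.sqrt (4 * r ^ 2 - s ^ 2) =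
      ∫ y, (Set.Icc (-ρ) ρ).indicator (fun _ => t - s) y := by
    rw [integral_indicator measurableSet_Icc, setIntegral_const, measureReal_def, Real.volume_Icc,
      ENNReal.toReal_ofReal (by linarith), smul_eq_mul, hρ]
    ring
  rw [h1]
  apply integral_mono
  · exact (integrable_luneSlice hr (hs.trans hst)).sub (integrable_luneSlice hr hs)
  · exact (integrable_indicator_iff measurableSet_Icc).2 (by simp)
  intro y
  by_cases hy : y ∈ Set.Icc (-ρ) ρ
  · rw [Set.indicator_of_mem hy]
    simp only [luneSlice]
    rcases le_total s (2 * Real.sqrt (r ^ 2 - y ^ 2)) with h | h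
    · rw [min_eq_left h]
      linarith [min_le_left t (2 * Real.sqrt (r ^ 2 - y ^ 2))]
    · rw [min_eq_right h, min_eq_right (h.trans hst)]
      linarith
  · rw [Set.indicator_of_notMem hy]
    rw [Set.mem_Icc, ← abs_le, not_le] at hy
    have : 2 * Real.sqrt (r ^ 2 - y ^ 2) ≤ s := by
      have : Real.sqrt (r ^ 2 - y ^ 2) ≤ s / 2 := by
        apply Real.sqrt_le_iff.2 ⟨by linarith, ?_⟩
        nlinarith [sq_abs y]
      linarith
    simp only [luneSlice]
    rw [min_eq_right this, min_eq_right (this.trans hst), sub_self]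

theorem luneArea_zero (r : ℝ) : luneArea r 0 = 0 := by
  simp [luneArea]

theorem luneArea_two_mul {r : ℝ} (hr : 0 < r) : luneArea r (2 * r) = Real.pi * r ^ 2 := by
  have hd : dist (!₂[2 * r, 0] : Plane) !₂[0, 0] = 2 * r := by
    have := dist_sq_coords (!₂[2 * r, 0] : Plane) !₂[0, 0]
    simp only [Matrix.cons_val_zero, Matrix.cons_val_one] at this
    rw [← sq_eq_sq₀ dist_nonneg (by linarith), this]; ring
  rw [luneArea, (Metric.ball_disjoint_ball (by rw [hd]; linarith)).sdiff_eq_left,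
    measureReal_def, EuclideanSpace.volume_ball_fin_two, ENNReal.toReal_mul, ENNReal.toReal_pow,
    ENNReal.toReal_ofReal hr.le, ENNReal.toReal_ofReal Real.pi_pos.le, mul_comm]

theorem luneArea_mono {r s t : ℝ} (hr : 0 < r) (hs : 0 ≤ s) (hst : s ≤ t) (ht : t ≤ 2 * r) :
    luneArea r s ≤ luneArea r t := by
  have := luneArea_sub_ge hr hs hst ht
  have h2 : 0 ≤ (t - s) * Real.sqrt (4 * r ^ 2 - t ^ 2) :=
    mul_nonneg (by linarith) (Real.sqrt_nonneg _)
  linarith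

theorem continuousOn_luneArea {r : ℝ} (hr : 0 < r) :
    ContinuousOn (luneArea r) (Set.Icc 0 (2 * r)) := by
  have : LipschitzOnWith (2 * r).toNNReal (luneArea r) (Set.Icc 0 (2 * r)) := by
    apply LipschitzOnWith.of_le_add_mul
    intro t ht s hs
    rw [Real.coe_toNNReal _ (by linarith), Real.dist_eq]
    rcases le_total t s with h | h
    · have := luneArea_mono hr ht.1 h hs.2
      have : 0 ≤ 2 * r * |t - s| := by positivity
      linarith
    · have h1 := luneArea_sub_le hr hs.1 h ht.2
      have h2 : Real.sqrt (4 * r ^ 2 - s ^ 2) ≤ 2 * r :=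
        Real.sqrt_le_iff.2 ⟨by linarith, by nlinarith [sq_nonneg s]⟩
      rw [abs_of_nonneg (by linarith)]
      have := mul_le_mul_of_nonneg_left h2 (show 0 ≤ t - s by linarith)
      linarith
  exact this.continuousOn

theorem luneAreaInv_spec {r y : ℝ} (hr : 0 < r) (h0 : 0 ≤ y) (h1 : y ≤ Real.pi * r ^ 2) :
    luneAreaInv r y ∈ Set.Icc 0 (2 * r) ∧ luneArea r (luneAreaInv r y) = y := by
  have : ∃ a ∈ Set.Icc 0 (2 * r), luneArea r a = y := by
    have := intermediate_value_Icc (show (0 : ℝ) ≤ 2 * r by linarith) (continuousOn_luneArea hr)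
    rw [luneArea_zero, luneArea_two_mul hr] at this
    obtain ⟨a, ha, rfl⟩ := this ⟨h0, h1⟩
    exact ⟨a, ha, rfl⟩
  exact Function.invFunOn_pos this

/-- The area of a lune depends only on the distance of the centres. -/
theorem volume_ball_sdiff_ball (a b : Plane) (r : ℝ) :
    volume.real (Metric.ball a r \ Metric.ball b r) = luneArea r (dist a b) := by
  have hn : ‖a - b‖ = ‖(!₂[dist a b, 0] : Plane)‖ := by
    rw [EuclideanSpace.norm_eq !₂[dist a b, 0], Fin.sum_univ_two]
    simp [dist_eq_norm]
  -- After `b` is moved to the origin, this reflection takes `a - b` to the vector of the same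
  -- length on the first axis.
  set f := (Submodule.span ℝ {(a - b) - (!₂[dist a b, 0] : Plane)})ᗮ.reflection with hf
  have hfab : f (a - b) = !₂[dist a b, 0] := Submodule.reflection_sub hn
  have hmp : MeasurePreserving (fun x : Plane => f (x - b)) volume volume :=
    f.measurePreserving.comp (measurePreserving_sub_right volume b)
  have hdist : ∀ x y : Plane, dist (f (x - b)) (f (y - b)) = dist x y := by
    intro x y; rw [f.dist_map, dist_sub_right]
  have hfb : f (b - b) = (!₂[0, 0] : Plane) := by
    rw [sub_self, map_zero]; ext i; fin_cases i <;> rfl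
  rw [luneArea, measureReal_def, measureReal_def]
  congr 1
  refine Eq.trans ?_ (hmp.measure_preimage
    (measurableSet_ball.diff measurableSet_ball).nullMeasurableSet)
  congr 1
  ext x
  simp only [Set.mem_sdiff, Metric.mem_ball, Set.mem_preimage]
  rw [← hfab, ← hfb, hdist, hdist]

theorem volume_real_ball (a : Plane) {r : ℝ} (hr : 0 < r) :
    volume.real (Metric.ball a r) = Real.pi * r ^ 2 := by
  rw [measureReal_def, EuclideanSpace.volume_ball_fin_two, ENNReal.toReal_mul, ENNReal.toReal_pow,
    ENNReal.toReal_ofReal hr.le, ENNReal.toReal_ofReal Real.pi_pos.le, mul_comm]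

theorem volume_ball_inter_ball (a b : Plane) {r : ℝ} (hr : 0 < r) :
    volume.real (Metric.ball a r ∩ Metric.ball b r) = Real.pi * r ^ 2 - luneArea r (dist a b) := by
  have := measureReal_sdiff_add_inter (μ := volume) (s := Metric.ball a r)
    (t := Metric.ball b r) measurableSet_ball (measure_ball_lt_top.ne)
  rw [volume_ball_sdiff_ball, volume_real_ball a hr] at this
  linarith

theorem luneArea_lt {r s t : ℝ} (hr : 0 < r) (hs : 0 ≤ s) (hst : s < t) (ht : t ≤ 2 * r) :
    luneArea r s < luneArea r t := by
  -- The slope bound is taken up to the midpoint only, because it degenerates at `t = 2r`.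
  have h1 := luneArea_sub_ge hr hs (show s ≤ (s + t) / 2 by linarith) (by linarith)
  have h2 := luneArea_mono hr (show 0 ≤ (s + t) / 2 by linarith)
    (show (s + t) / 2 ≤ t by linarith) ht
  have h3 : 0 < ((s + t) / 2 - s) * Real.sqrt (4 * r ^ 2 - ((s + t) / 2) ^ 2) := by
    apply mul_pos (by linarith)
    apply Real.sqrt_pos.2
    nlinarith
  linarith

theorem luneArea_le {r t : ℝ} (hr : 0 < r) (h0 : 0 ≤ t) (ht : t ≤ 2 * r) :
    luneArea r t ≤ Real.pi * r ^ 2 := by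
  rw [← luneArea_two_mul hr]; exact luneArea_mono hr h0 ht le_rfl

theorem luneArea_nonneg (r t : ℝ) : 0 ≤ luneArea r t := measureReal_nonneg

theorem le_of_luneArea_le {r s t : ℝ} (hr : 0 < r) (ht : 0 ≤ t) (hs : s ≤ 2 * r)
    (h : luneArea r s ≤ luneArea r t) : s ≤ t := by
  by_contra hc
  exact absurd (luneArea_lt hr ht (not_le.1 hc) hs) (not_lt.2 h)

/-- Away from `2 r` the function `luneArea r` expands distances by the factor `3 r / 2`. -/
theorem abs_luneArea_sub_ge_of_le {r s t : ℝ} (hr : 0 < r) (hs : 0 ≤ s) (hs' : s ≤ r)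
    (ht : 0 ≤ t) (ht' : t ≤ r) :
    |s - t| * (3 / 2 * r) ≤ |luneArea r s - luneArea r t| := by
  wlog h : t ≤ s generalizing s t
  · rw [abs_sub_comm s, abs_sub_comm (luneArea r s)]
    exact this ht ht' hs hs' (by linarith)
  have h1 := luneArea_sub_ge hr ht h (by linarith)
  have h2 : 3 / 2 * r ≤ Real.sqrt (4 * r ^ 2 - s ^ 2) := Real.le_sqrt_of_sq_le (by nlinarith)
  rw [abs_of_nonneg (sub_nonneg.2 h)]
  exact (mul_le_mul_of_nonneg_left h2 (sub_nonneg.2 h)).trans (h1.trans (le_abs_self _))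

/-- Near `2 r` the function `luneArea r` expands distances by a square root factor. -/
theorem abs_luneArea_sub_ge_of_ge {r s t : ℝ} (hr : 0 < r) (hs : r ≤ s) (hs' : s ≤ 2 * r)
    (ht : r ≤ t) (ht' : t ≤ 2 * r) :
    |s - t| * (3 / 5 * Real.sqrt (r * (2 * r - min s t))) ≤ |luneArea r s - luneArea r t| := by
  wlog h : t ≤ s generalizing s t
  · rw [abs_sub_comm s, abs_sub_comm (luneArea r s), min_comm]
    exact this ht ht' hs hs' (by linarith)
  rw [min_eq_right h]
  have h1 := luneArea_sub_ge hr (show 0 ≤ t by linarith) (show t ≤ (s + t) / 2 by linarith)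
    (by linarith)
  have h2 := luneArea_mono hr (show 0 ≤ (s + t) / 2 by linarith)
    (show (s + t) / 2 ≤ s by linarith) hs'
  -- At the midpoint `c` of `t` and `s` one has `2r - c ≥ (2r - t)/2` and `2r + c ≥ 3r`, and `(6/5)²
  -- < 3/2`.
  have h3 : 6 / 5 * Real.sqrt (r * (2 * r - t)) ≤ Real.sqrt (4 * r ^ 2 - ((s + t) / 2) ^ 2) := by
    apply Real.le_sqrt_of_sq_le
    rw [mul_pow, Real.sq_sqrt (mul_nonneg hr.le (by linarith))]
    nlinarith [mul_nonneg (show 0 ≤ 2 * r - (s + t) / 2 by linarith)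
      (show 0 ≤ (s + t) / 2 - r by linarith), mul_nonneg hr.le (sub_nonneg.2 hs'),
      mul_nonneg hr.le (sub_nonneg.2 ht')]
  rw [abs_of_nonneg (sub_nonneg.2 h)]
  have h4 := mul_le_mul_of_nonneg_left h3 (show 0 ≤ (s - t) / 2 by linarith)
  refine le_trans ?_ (le_abs_self _)
  have e : (s + t) / 2 - t = (s - t) / 2 := by ring
  rw [e] at h1
  nlinarith

/-! ### Inverting the lune area at a noisy count. -/

/-- The deviation allowed for the number of points in a region of area `a`. -/
noncomputable def deviation (l a : ℝ) : ℝ := 2 * Real.sqrt (3 * a * l) + 10 * l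

/-- The count error is at most `19 r √l`, since the lune has area at most `4r²`, and the slope is at
least `3r/2` on `[0, r]`. The extra `2` allows for the two centres, which are vertices themselves.
-/
theorem abs_luneAreaInv_min_sub_le {r t m l : ℝ} (hl : 1 ≤ l) (hlr : l ^ 2 ≤ r) (ht : 0 ≤ t)
    (htr : t ≤ r) (hm : 0 ≤ m) (h : |m - luneArea r t| ≤ deviation l (luneArea r t) + 2) :
    |luneAreaInv r (min m (luneArea r r)) - t| ≤ 100 * Real.sqrt l := by
  have hr : 0 < r := by nlinarith
  have hFr := luneArea_nonneg r r
  have hpi := Real.pi_lt_four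
  obtain ⟨⟨hd0, hd2⟩, hF⟩ := luneAreaInv_spec (y := min m (luneArea r r)) hr (le_min hm hFr)
    ((min_le_right _ _).trans (luneArea_le hr hr.le (by linarith)))
  set d := luneAreaInv r (min m (luneArea r r))
  have hdr : d ≤ r := le_of_luneArea_le hr hr.le hd2 (hF.trans_le (min_le_right _ _))
  have h1 := abs_luneArea_sub_ge_of_le hr hd0 hdr ht htr
  have htr' := luneArea_mono hr ht htr (by linarith)
  -- As `t ≤ r`, truncation at `luneArea r r` can only bring the count closer to the true area.
  have h2 : |luneArea r d - luneArea r t| ≤ |m - luneArea r t| := by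
    rw [hF]
    rcases le_total m (luneArea r r) with h3 | h3
    · rw [min_eq_left h3]
    · rw [min_eq_right h3, abs_of_nonneg (by linarith), abs_of_nonneg (by linarith)]
      linarith
  set k := Real.sqrt l
  have hk : k ^ 2 = l := Real.sq_sqrt (by linarith)
  have hk1 : 1 ≤ k := Real.one_le_sqrt.2 hl
  have hkr : k ≤ r := by nlinarith
  have h4 : Real.sqrt (3 * luneArea r t * l) ≤ 7 / 2 * (r * k) := by
    apply Real.sqrt_le_iff.2 ⟨by positivity, ?_⟩
    have : luneArea r t ≤ 4 * r ^ 2 :=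
      (luneArea_le hr ht (by linarith)).trans (mul_le_mul_of_nonneg_right hpi.le (by positivity))
    rw [mul_pow, mul_pow, hk]
    nlinarith [mul_le_mul_of_nonneg_right this (show 0 ≤ l by linarith)]
  have h5 : |d - t| * (3 / 2 * r) ≤ 19 * k * r := by
    refine (h1.trans (h2.trans h)).trans ?_
    rw [deviation]
    nlinarith
  have : |d - t| * (3 / 2) ≤ 19 * k := by
    refine le_of_mul_le_mul_right ?_ hr
    linarith
  linarith

/-- With `S` the larger of the gaps of the estimate and of `t` below `2r`, and `q = √(rS)`, the
slope is of order `q` and the lens has area at most `2Sq ≤ 2q²`. The count error is then of order `q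
√l`, and `q` cancels. -/
theorem abs_luneAreaInv_max_sub_le {r t m l : ℝ} (hl : 1 ≤ l) (hlr : l ^ 2 ≤ r) (ht : r ≤ t)
    (htr : t ≤ 2 * r) (hm : 0 ≤ m)
    (h : |m - (Real.pi * r ^ 2 - luneArea r t)| ≤
      deviation l (Real.pi * r ^ 2 - luneArea r t) + 2) :
    |luneAreaInv r (max (luneArea r r) (Real.pi * r ^ 2 - m)) - t| ≤ 100 * Real.sqrt l := by
  have hr : 0 < r := by nlinarith
  have hFr := luneArea_nonneg r r
  obtain ⟨⟨hd0, hd2⟩, hF⟩ := luneAreaInv_spec (y := max (luneArea r r) (Real.pi * r ^ 2 - m)) hr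
    (le_max_of_le_left hFr) (max_le (luneArea_le hr hr.le (by linarith)) (by linarith))
  set d := luneAreaInv r (max (luneArea r r) (Real.pi * r ^ 2 - m))
  have hdr : r ≤ d := le_of_luneArea_le hr hd0 (by linarith) ((le_max_left _ _).trans_eq hF.symm)
  have h1 := abs_luneArea_sub_ge_of_ge hr hdr hd2 ht htr
  have htr' := luneArea_mono hr hr.le ht htr
  have h2 : |luneArea r d - luneArea r t| ≤ |m - (Real.pi * r ^ 2 - luneArea r t)| := by
    rw [hF]
    rcases le_total (luneArea r r) (Real.pi * r ^ 2 - m) with h3 | h3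
    · rw [max_eq_right h3, abs_sub_comm]
      apply le_of_eq; congr 1; ring
    · rw [max_eq_left h3, abs_of_nonpos (by linarith), abs_of_nonneg (by linarith)]
      linarith
  set k := Real.sqrt l
  have hk : k ^ 2 = l := Real.sq_sqrt (by linarith)
  have hk1 : 1 ≤ k := Real.one_le_sqrt.2 hl
  set S := 2 * r - min d t with hS
  have hS0 : 0 ≤ S := by linarith [min_le_left d t]
  have hSr : S ≤ r := by linarith [le_min hdr ht]
  have hΔ : |d - t| ≤ S := by
    rw [abs_le]
    constructor <;> linarith [min_le_left d t, min_le_right d t]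
  -- For `S ≤ √l` both numbers lie within `√l` of `2r` and nothing is left to prove. Otherwise `S ≥
  -- 1`, so `l² ≤ r` gives `l ≤ q`, which absorbs the linear term of the deviation.
  rcases le_total S k with hSk | hSk
  · linarith
  set q := Real.sqrt (r * S)
  have hq : q ^ 2 = r * S := Real.sq_sqrt (by positivity)
  have hq0 : 0 ≤ q := Real.sqrt_nonneg _
  have hSq : S ≤ q := Real.le_sqrt_of_sq_le (by nlinarith)
  have hlq : l ≤ q := Real.le_sqrt_of_sq_le (by nlinarith)
  have hL : Real.pi * r ^ 2 - luneArea r t ≤ 2 * S * q := by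
    have hmin : r ≤ min d t := le_min hdr ht
    have e1 := luneArea_sub_le hr (show 0 ≤ min d t by linarith)
      ((min_le_left d t).trans hd2) le_rfl
    have e2 := luneArea_mono hr (show 0 ≤ min d t by linarith) (min_le_right d t) htr
    rw [luneArea_two_mul hr] at e1
    have e3 : Real.sqrt (4 * r ^ 2 - min d t ^ 2) ≤ 2 * q := by
      apply Real.sqrt_le_iff.2 ⟨by positivity, ?_⟩
      rw [mul_pow, hq]
      have : min d t = 2 * r - S := by rw [hS]; ring
      rw [this]
      nlinarith
    have e4 := mul_le_mul_of_nonneg_left e3 hS0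
    linarith
  have h4 : Real.sqrt (3 * (Real.pi * r ^ 2 - luneArea r t) * l) ≤ 5 / 2 * (q * k) := by
    apply Real.sqrt_le_iff.2 ⟨by positivity, ?_⟩
    have : Real.pi * r ^ 2 - luneArea r t ≤ 2 * q ^ 2 := by nlinarith
    rw [mul_pow, mul_pow, hk]
    nlinarith [mul_le_mul_of_nonneg_right this (show 0 ≤ l by linarith),
      mul_nonneg (sq_nonneg q) (show 0 ≤ l by linarith)]
  have h5 : |d - t| * (3 / 5 * q) ≤ 17 * k * q := by
    refine (h1.trans (h2.trans h)).trans ?_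
    rw [deviation]
    nlinarith
  have hqpos : 0 < q := by linarith
  have : |d - t| * (3 / 5) ≤ 17 * k := by
    refine le_of_mul_le_mul_right ?_ hqpos
    linarith
  linarith

/-! ### Chernoff's bound for an independent family, and conditioning on two of its members. -/

/-- The number of coordinates of `x` that lie in `S`. -/
noncomputable def pointCount {ι Ω : Type*} [Fintype ι] (x : ι → Ω) (S : Set Ω) : ℝ :=
  ∑ k, S.indicator (fun _ => 1) (x k)

theorem pointCount_eq_ncard {ι Ω : Type*} [Fintype ι] (x : ι → Ω) (S : Set Ω) :
    pointCount x S = ({k | x k ∈ S}.ncard : ℝ) := by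
  classical
  rw [pointCount, Set.ncard_eq_toFinset_card', Set.toFinset_ofPred, Finset.card_filter]
  push_cast
  exact Finset.sum_congr rfl fun k _ => by by_cases h : x k ∈ S <;> simp [h]

section ProductMeasure

variable {ι Ω : Type*} [Fintype ι] [MeasurableSpace Ω]

/-- Resampling the coordinates outside `s` does not change the law of an i.i.d. family. -/
theorem measurePreserving_piecewise (μ : Measure Ω) [IsProbabilityMeasure μ] (s : Set ι)
    [DecidablePred (· ∈ s)] :
    MeasurePreserving (fun z : (ι → Ω) × (ι → Ω) => fun k => if k ∈ s then z.1 k else z.2 k)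
      ((Measure.pi fun _ : ι => μ).prod (Measure.pi fun _ : ι => μ))
      (Measure.pi fun _ : ι => μ) := by
  have hm : Measurable
      (fun z : (ι → Ω) × (ι → Ω) => fun k => if k ∈ s then z.1 k else z.2 k) := by
    refine measurable_pi_lambda _ fun k => ?_
    by_cases hk : k ∈ s
    · simp only [hk, if_true]; fun_prop
    · simp only [hk, if_false]; fun_prop
  refine ⟨hm, (Measure.pi_eq fun B hB => ?_).symm⟩
  rw [Measure.map_apply hm (MeasurableSet.univ_pi hB)]
  have : (fun z : (ι → Ω) × (ι → Ω) => fun k => if k ∈ s then z.1 k else z.2 k) ⁻¹'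
      (Set.univ.pi B) = (Set.univ.pi fun k => if k ∈ s then B k else Set.univ) ×ˢ
        (Set.univ.pi fun k => if k ∈ s then Set.univ else B k) := by
    ext z
    simp only [Set.mem_preimage, Set.mem_pi, Set.mem_univ, true_implies, Set.mem_prod]
    rw [← forall_and]
    refine forall_congr' fun k => ?_
    by_cases hk : k ∈ s <;> simp [hk]
  rw [this, Measure.prod_prod, Measure.pi_pi, Measure.pi_pi, ← Finset.prod_mul_distrib]
  refine Finset.prod_congr rfl fun k _ => ?_
  by_cases hk : k ∈ s <;> simp [hk]

/-- To bound the probability of an event on an i.i.d. family, condition on two coordinates. -/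
theorem measure_pi_le_of_forall {μ : Measure Ω} [IsProbabilityMeasure μ] (i j : ι)
    {B : Ω → Ω → (ι → Ω) → Prop} (hB : MeasurableSet {x : ι → Ω | B (x i) (x j) x})
    (hcongr : ∀ p q x y, (∀ k, k ≠ i → k ≠ j → x k = y k) → B p q x → B p q y)
    {ε : ℝ≥0∞} (h : ∀ p q, Measure.pi (fun _ : ι => μ) {x | B p q x} ≤ ε) :
    Measure.pi (fun _ : ι => μ) {x | B (x i) (x j) x} ≤ ε := by
  classical
  have hmp := measurePreserving_piecewise μ ({i, j} : Set ι)
  rw [← hmp.measure_preimage hB.nullMeasurableSet, Measure.prod_apply (hmp.measurable hB)]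
  calc _ ≤ ∫⁻ _ : ι → Ω, ε ∂(Measure.pi fun _ : ι => μ) := by
        -- The coordinates `i` and `j` come from `x`, all others from the independent copy `y`; by
        -- `hcongr` the event depends on `y` only through those others.
        refine lintegral_mono fun x => (measure_mono ?_).trans (h (x i) (x j))
        intro y hy
        have hy' : B _ _ _ := hy
        simp only [Set.mem_insert_iff, Set.mem_singleton_iff, true_or, or_true, if_true] at hy'
        exact hcongr _ _ _ _ (fun k hi hj => by simp [hi, hj]) hy'
    _ = ε := by simp

theorem measurable_pointCount {S : Set Ω} (hS : MeasurableSet S) :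
    Measurable fun x : ι → Ω => pointCount x S := by
  unfold pointCount
  exact Finset.measurable_sum _ fun k _ =>
    (measurable_const.indicator hS).comp (measurable_pi_apply k)

/-- By independence this is a power of `1 + μ(S)(e^t - 1)`, and `e^t - 1 ≤ t + t²` for `|t| ≤ 1`. -/
theorem integral_exp_pointCount_le {μ : Measure Ω} [IsProbabilityMeasure μ] {S : Set Ω}
    (hS : MeasurableSet S) {t : ℝ} (ht : |t| ≤ 1) :
    ProbabilityTheory.mgf (fun x : ι → Ω => pointCount x S) (Measure.pi fun _ : ι => μ) t ≤
      Real.exp (Fintype.card ι * μ.real S * (t + t ^ 2)) := by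
  unfold ProbabilityTheory.mgf
  have h1 : ∀ x : ι → Ω, Real.exp (t * pointCount x S) =
      ∏ k, Real.exp (t * S.indicator (fun _ => 1) (x k)) := by
    intro x
    rw [pointCount, Finset.mul_sum, Real.exp_sum]
  simp only [h1]
  rw [integral_fintype_prod_eq_prod (𝕜 := ℝ)
    (fun (_ : ι) (z : Ω) => Real.exp (t * S.indicator (fun _ => 1) z))]
  have h2 : ∫ z, Real.exp (t * S.indicator (fun _ => (1 : ℝ)) z) ∂μ =
      1 + μ.real S * (Real.exp t - 1) := by
    have : ∀ z, Real.exp (t * S.indicator (fun _ => (1 : ℝ)) z) =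
        1 + S.indicator (fun _ => Real.exp t - 1) z := by
      intro z; by_cases hz : z ∈ S <;> simp [hz]
    simp only [this]
    rw [integral_add (integrable_const _)
      ((integrable_const _).indicator hS), integral_indicator hS, setIntegral_const]
    simp
  simp only [h2, Finset.prod_const, Finset.card_univ]
  have h3 : 1 + μ.real S * (Real.exp t - 1) ≤ Real.exp (μ.real S * (t + t ^ 2)) := by
    have h4 : Real.exp t - 1 ≤ t + t ^ 2 := by
      have := Real.abs_exp_sub_one_sub_id_le ht
      linarith [(abs_le.1 this).2]
    have h5 := mul_le_mul_of_nonneg_left h4 (measureReal_nonneg (μ := μ) (s := S))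
    linarith [Real.add_one_le_exp (μ.real S * (t + t ^ 2))]
  have h6 : 0 ≤ 1 + μ.real S * (Real.exp t - 1) := by
    rw [← h2]; exact integral_nonneg fun z => (Real.exp_pos _).le
  calc _ ≤ Real.exp (μ.real S * (t + t ^ 2)) ^ Fintype.card ι := pow_le_pow_left₀ h6 h3 _
    _ = _ := by rw [← Real.exp_nat_mul]; congr 1; ring

/-- The exponent for Chernoff's bound is `min(1, √(L/A))`: the cap at `1` keeps the quadratic
estimate of the exponential valid and produces the term `2L`. -/
theorem exists_exponent {A L : ℝ} (hL : 0 < L) :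
    ∃ t : ℝ, 0 ≤ t ∧ t ≤ 1 ∧ A * t ^ 2 - t * (2 * Real.sqrt (A * L) + 2 * L) ≤ -L := by
  rcases le_total L A with h | h
  · have hA' : 0 < A := hL.trans_le h
    refine ⟨Real.sqrt (L / A), Real.sqrt_nonneg _, ?_, ?_⟩
    · exact Real.sqrt_le_one.2 ((div_le_one hA').2 h)
    · have e1 : Real.sqrt (L / A) * Real.sqrt (A * L) = L := by
        rw [← Real.sqrt_mul (by positivity), show L / A * (A * L) = L ^ 2 by field_simp,
          Real.sqrt_sq hL.le]
      have e2 : A * Real.sqrt (L / A) ^ 2 = L := by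
        rw [Real.sq_sqrt (by positivity)]; field_simp
      have := Real.sqrt_nonneg (L / A)
      nlinarith
  · refine ⟨1, zero_le_one, le_rfl, ?_⟩
    have := Real.sqrt_nonneg (A * L)
    linarith

theorem integrable_exp_mul_pointCount {μ : Measure Ω} [IsProbabilityMeasure μ] {S : Set Ω}
    (hS : MeasurableSet S) (t : ℝ) :
    Integrable (fun x : ι → Ω => Real.exp (t * pointCount x S))
      (Measure.pi fun _ : ι => μ) := by
  refine Integrable.of_bound (C := Real.exp (|t| * Fintype.card ι))
    (Real.measurable_exp.comp ((measurable_pointCount hS).const_mul t)).aestronglyMeasurable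
    (ae_of_all _ fun x => ?_)
  rw [Real.norm_eq_abs, Real.abs_exp, Real.exp_le_exp]
  refine (le_abs_self _).trans ?_
  rw [abs_mul]
  refine mul_le_mul_of_nonneg_left ?_ (abs_nonneg _)
  rw [pointCount_eq_ncard, Nat.abs_cast, Nat.cast_le]
  exact (Set.ncard_le_card _).trans_eq Nat.card_eq_fintype_card

/-- Chernoff's bound for the number of points of an i.i.d. family in a set. -/
theorem measure_abs_pointCount_sub_ge_le {μ : Measure Ω} [IsProbabilityMeasure μ] {S : Set Ω}
    (hS : MeasurableSet S) {A L : ℝ} (hA : A = Fintype.card ι * μ.real S) (hL : 0 < L) :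
    Measure.pi (fun _ : ι => μ)
      {x : ι → Ω | 2 * Real.sqrt (A * L) + 2 * L ≤ |pointCount x S - A|} ≤
      ENNReal.ofReal (2 * Real.exp (-L)) := by
  have hA0 : 0 ≤ A := by rw [hA]; positivity
  obtain ⟨t, ht0, ht1, ht⟩ := exists_exponent hL
  set d := 2 * Real.sqrt (A * L) + 2 * L
  set P := Measure.pi (fun _ : ι => μ)
  have h1 : P.real {x | A + d ≤ pointCount x S} ≤ Real.exp (-L) := by
    refine (ProbabilityTheory.measure_ge_le_exp_mul_mgf (A + d) ht0
      (integrable_exp_mul_pointCount hS t)).trans ?_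
    refine (mul_le_mul_of_nonneg_left (integral_exp_pointCount_le hS
      (abs_le.2 ⟨by linarith, ht1⟩)) (Real.exp_pos _).le).trans ?_
    rw [← Real.exp_add, Real.exp_le_exp, ← hA]
    linarith
  have h2 : P.real {x | pointCount x S ≤ A - d} ≤ Real.exp (-L) := by
    refine (ProbabilityTheory.measure_le_le_exp_mul_mgf (A - d) (neg_nonpos.2 ht0)
      (integrable_exp_mul_pointCount hS (-t))).trans ?_
    refine (mul_le_mul_of_nonneg_left (integral_exp_pointCount_le hS
      (abs_le.2 ⟨by linarith, by linarith⟩)) (Real.exp_pos _).le).trans ?_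
    rw [← Real.exp_add, Real.exp_le_exp, ← hA]
    linarith
  have h3 : {x : ι → Ω | d ≤ |pointCount x S - A|} ⊆
      {x | A + d ≤ pointCount x S} ∪ {x | pointCount x S ≤ A - d} := by
    intro x hx
    rcases le_abs.1 (show d ≤ |pointCount x S - A| from hx) with h | h
    · left; show A + d ≤ pointCount x S; linarith
    · right; show pointCount x S ≤ A - d; linarith
  rw [← ofReal_measureReal]
  apply ENNReal.ofReal_le_ofReal
  calc _ ≤ P.real ({x | A + d ≤ pointCount x S} ∪ {x | pointCount x S ≤ A - d}) :=
        measureReal_mono h3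
    _ ≤ _ := measureReal_union_le _ _
    _ ≤ _ := by linarith

end ProductMeasure

/-! ### The uniform law on the square and concentration of the counts. -/

theorem measurableSet_square (n : ℕ) : MeasurableSet (square n) := by
  have : square n = ⋂ i : Fin 2, (fun p : Plane => p i) ⁻¹' Set.Icc 0 (Real.sqrt n) := by
    ext p; simp [square]
  rw [this]
  exact MeasurableSet.iInter fun i =>
    (show Measurable fun p : Plane => p i by fun_prop) measurableSet_Icc

theorem volume_setOf_coords (I J : Set ℝ) (hI : MeasurableSet I) (hJ : MeasurableSet J) :
    volume {p : Plane | p 0 ∈ I ∧ p 1 ∈ J} = volume I * volume J := by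
  rw [← Measure.prod_prod, ← Measure.volume_eq_prod,
    ← measurePreserving_coords.measure_preimage (hI.prod hJ).nullMeasurableSet]
  rfl

theorem volume_square (n : ℕ) : volume (square n) = n := by
  have : square n = {p : Plane | p 0 ∈ Set.Icc 0 (Real.sqrt n) ∧ p 1 ∈ Set.Icc 0 (Real.sqrt n)} := by
    ext p; simp [square, Fin.forall_fin_two]
  rw [this, volume_setOf_coords _ _ measurableSet_Icc measurableSet_Icc, Real.volume_Icc, sub_zero,
    ← ENNReal.ofReal_mul (Real.sqrt_nonneg _), Real.mul_self_sqrt (Nat.cast_nonneg n),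
    ENNReal.ofReal_natCast]

/-- The uniform law on the square. -/
noncomputable abbrev squareLaw (n : ℕ) : Measure Plane := ProbabilityTheory.cond volume (square n)

theorem isProbabilityMeasure_squareLaw {n : ℕ} (hn : n ≠ 0) :
    IsProbabilityMeasure (squareLaw n) :=
  ProbabilityTheory.cond_isProbabilityMeasure_of_finite (by simp [volume_square, hn])
    (by simp [volume_square])

theorem squareLaw_real {n : ℕ} (S : Set Plane) :
    (squareLaw n).real S = volume.real (square n ∩ S) / n := by
  rw [measureReal_def, ProbabilityTheory.cond_apply (measurableSet_square n), volume_square,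
    ENNReal.toReal_mul, ENNReal.toReal_inv, ENNReal.toReal_natCast, measureReal_def, inv_mul_eq_div]

theorem abs_sum_sub_sum_le_two {ι : Type*} [Fintype ι] {f g : ι → ℝ} {i j : ι}
    (h : ∀ k, k ≠ i → k ≠ j → f k = g k) (hfg : ∀ k, |f k - g k| ≤ 1) :
    |∑ k, f k - ∑ k, g k| ≤ 2 := by
  classical
  rw [← Finset.sum_sub_distrib]
  have h1 : ∑ k, (f k - g k) = ∑ k ∈ ({i, j} : Finset ι), (f k - g k) := by
    refine (Finset.sum_subset (Finset.subset_univ _) fun k _ hk => ?_).symm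
    simp only [Finset.mem_insert, Finset.mem_singleton, not_or] at hk
    rw [h k hk.1 hk.2, sub_self]
  rw [h1]
  refine (Finset.abs_sum_le_sum_abs _ _).trans ((Finset.sum_le_card_nsmul _ _ 1
    fun k _ => hfg k).trans ?_)
  have := Finset.card_le_two (a := i) (b := j)
  simp only [nsmul_eq_mul, mul_one]
  exact_mod_cast this

/-- Concentration for the number of points in a region that depends on two of the points. -/
theorem pointsLaw_deviation_le {n : ℕ} (hn : 1 ≤ Real.log n) (i j : Fin n)
    {R : Set ((Plane × Plane) × Plane)} (hR : MeasurableSet R) :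
    pointsLaw n {x | deviation (Real.log n) (volume.real (square n ∩ Prod.mk (x i, x j) ⁻¹' R)) <
        |pointCount x (Prod.mk (x i, x j) ⁻¹' R) -
          volume.real (square n ∩ Prod.mk (x i, x j) ⁻¹' R)|} ≤
      ENNReal.ofReal (2 / (n : ℝ) ^ 3) := by
  have hn0 : n ≠ 0 := by rintro rfl; norm_num at hn
  have hnpos : (0 : ℝ) < n := by positivity
  have := isProbabilityMeasure_squareLaw hn0
  set l := Real.log n
  set A : Plane × Plane → ℝ := fun p => volume.real (square n ∩ Prod.mk p ⁻¹' R) with hAdef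
  have hAm : Measurable A := by
    have : A = fun p => ((volume.restrict (square n)) (Prod.mk p ⁻¹' R)).toReal := by
      ext p
      rw [Measure.restrict_apply (measurable_prodMk_left hR), Set.inter_comm]
      rfl
    rw [this]
    exact (measurable_measure_prodMk_left hR).ennreal_toReal
  classical
  -- Dropping the indices `i` and `j` makes the count independent of the two points that define the
  -- region. Passing to this count and back costs `2` each time; with `L = 3 log n` in Chernoff's
  -- bound this gives `6l + 4 ≤ 10l`, the linear term of `deviation`.
  set f : (Plane × Plane) → (Fin n → Plane) → Fin n → ℝ :=
    fun p x k => if k = i ∨ k = j then 0 else (Prod.mk p ⁻¹' R).indicator (fun _ => 1) (x k)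
  have hfm : Measurable fun z : (Plane × Plane) × (Fin n → Plane) => ∑ k, f z.1 z.2 k := by
    refine Finset.measurable_sum _ fun k _ => ?_
    by_cases hk : k = i ∨ k = j
    · simp [f, hk]
    · simp only [f, hk, if_false]
      have : (fun z : (Plane × Plane) × (Fin n → Plane) =>
          (Prod.mk z.1 ⁻¹' R).indicator (fun _ => (1 : ℝ)) (z.2 k)) =
          ((fun z : (Plane × Plane) × (Fin n → Plane) => (z.1, z.2 k)) ⁻¹' R).indicator
            (fun _ => 1) := by
        ext z; rfl
      rw [this]
      exact measurable_const.indicator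
        ((show Measurable fun z : (Plane × Plane) × (Fin n → Plane) => (z.1, z.2 k) by fun_prop) hR)
  have hfc : ∀ p x, |pointCount x (Prod.mk p ⁻¹' R) - ∑ k, f p x k| ≤ 2 := by
    intro p x
    refine abs_sum_sub_sum_le_two (i := i) (j := j) (fun k hi hj => by simp [f, hi, hj]) fun k => ?_
    by_cases hk : k = i ∨ k = j <;> by_cases hx : x k ∈ Prod.mk p ⁻¹' R <;>
      simp only [f, hk, hx, if_true, if_false, Set.indicator_of_mem, Set.indicator_of_notMem,
        not_false_eq_true] <;> norm_num
  have hsub : {x : Fin n → Plane | deviation l (A (x i, x j)) <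
      |pointCount x (Prod.mk (x i, x j) ⁻¹' R) - A (x i, x j)|} ⊆
      {x | 2 * Real.sqrt (A (x i, x j) * (3 * l)) + 2 * (3 * l) + 2 ≤
        |∑ k, f (x i, x j) x k - A (x i, x j)|} := by
    intro x hx
    have hx' : deviation l (A (x i, x j)) <
      |pointCount x (Prod.mk (x i, x j) ⁻¹' R) - A (x i, x j)| := hx
    rw [deviation, show 3 * A (x i, x j) * l = A (x i, x j) * (3 * l) by ring] at hx'
    have h1 := hfc (x i, x j) x
    have h2 := abs_sub_le (pointCount x (Prod.mk (x i, x j) ⁻¹' R)) (∑ k, f (x i, x j) x k)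
      (A (x i, x j))
    rw [Set.mem_ofPred_eq]
    linarith
  refine (measure_mono hsub).trans (measure_pi_le_of_forall (μ := squareLaw n) i j
    (B := fun p q x => 2 * Real.sqrt (A (p, q) * (3 * l)) + 2 * (3 * l) + 2 ≤
        |∑ k, f (p, q) x k - A (p, q)|) ?_ ?_ ?_)
  · have hmp : Measurable fun x : Fin n → Plane => (x i, x j) := by fun_prop
    have hA2 := hAm.comp hmp
    have hf2 := hfm.comp (hmp.prodMk measurable_id)
    refine measurableSet_le (f := fun x : Fin n → Plane =>
      2 * Real.sqrt (A (x i, x j) * (3 * l)) + 2 * (3 * l) + 2)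
      (g := fun x : Fin n → Plane => |∑ k, f (x i, x j) x k - A (x i, x j)|) ?_ ?_
    · exact ((((hA2.mul_const _).sqrt).const_mul _).add_const _).add_const _
    · exact (hf2.sub hA2).norm
  · intro p q x y hxy h
    have : ∀ k, f (p, q) x k = f (p, q) y k := by
      intro k
      simp only [f]
      split_ifs with hk
      · rfl
      · rw [not_or] at hk; rw [hxy k hk.1 hk.2]
    simpa only [this] using h
  · intro p q
    have hS : MeasurableSet (Prod.mk (p, q) ⁻¹' R) := measurable_prodMk_left hR
    have hA : A (p, q) = Fintype.card (Fin n) * (squareLaw n).real (Prod.mk (p, q) ⁻¹' R) := by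
      rw [squareLaw_real, Fintype.card_fin, mul_div_cancel₀ _ hnpos.ne']
    have hexp : Real.exp (-(3 * l)) = 1 / (n : ℝ) ^ 3 := by
      rw [Real.exp_neg, show 3 * l = ((3 : ℕ) : ℝ) * l by norm_num, Real.exp_nat_mul,
        Real.exp_log hnpos, one_div]
    refine (measure_mono ?_).trans ((measure_abs_pointCount_sub_ge_le hS hA
      (show 0 < 3 * l by linarith)).trans (le_of_eq ?_))
    · intro x hx
      have hx' : 2 * Real.sqrt (A (p, q) * (3 * l)) + 2 * (3 * l) + 2 ≤
        |∑ k, f (p, q) x k - A (p, q)| := hx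
      have h1 := hfc (p, q) x
      rw [abs_sub_comm] at h1
      have h2 := abs_sub_le (∑ k, f (p, q) x k) (pointCount x (Prod.mk (p, q) ⁻¹' R)) (A (p, q))
      rw [Set.mem_ofPred_eq]
      linarith
    · rw [hexp]; congr 1; ring

/-! ### Discs whose centres are near a side of the square. -/

theorem volume_real_box (i : Fin 2) (a b c d : ℝ) (hab : a ≤ b) (hcd : c ≤ d) :
    volume.real {z : Plane | z i ∈ Set.Ioo a b ∧ z (1 - i) ∈ Set.Ioo c d} = (b - a) * (d - c) := by
  have h : ∀ a b c d : ℝ, a ≤ b → c ≤ d →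
      volume.real {z : Plane | z 0 ∈ Set.Ioo a b ∧ z 1 ∈ Set.Ioo c d} = (b - a) * (d - c) := by
    intro a b c d hab hcd
    rw [measureReal_def, volume_setOf_coords _ _ measurableSet_Ioo measurableSet_Ioo,
      ENNReal.toReal_mul, Real.volume_Ioo, Real.volume_Ioo, ENNReal.toReal_ofReal (by linarith),
      ENNReal.toReal_ofReal (by linarith)]
  fin_cases i
  · exact h a b c d hab hcd
  · rw [mul_comm, ← h c d a b hcd hab]
    congr 1; ext z; exact and_comm

theorem measurableSet_box (i : Fin 2) (a b c d : ℝ) :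
    MeasurableSet {z : Plane | z i ∈ Set.Ioo a b ∧ z (1 - i) ∈ Set.Ioo c d} :=
  ((show Measurable fun p : Plane => p i by fun_prop) measurableSet_Ioo).inter
    ((show Measurable fun p : Plane => p (1 - i) by fun_prop) measurableSet_Ioo)

theorem dist_sq_coords' (i : Fin 2) (p q : Plane) :
    dist p q ^ 2 = (p i - q i) ^ 2 + (p (1 - i) - q (1 - i)) ^ 2 := by
  rw [dist_sq_coords]
  fin_cases i
  · rfl
  · exact add_comm _ _

/-- A disc whose centre is close to a side loses a definite part of its area. -/
theorem volume_real_square_inter_ball_le {n : ℕ} {r : ℝ} (hr : 0 < r) (p : Plane) (i : Fin 2)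
    (a b : ℝ) (ha : ∀ t ∈ Set.Ioo a (a + 2 / 5 * r), |t - p i| ≤ 7 / 5 * r)
    (hb : ∀ t ∈ Set.Ioo b (b + 2 / 5 * r), |t - p i| ≤ 9 / 5 * r)
    (ha' : ∀ t ∈ Set.Ioo a (a + 2 / 5 * r), t ∉ Set.Icc 0 (Real.sqrt n))
    (hb' : ∀ t ∈ Set.Ioo b (b + 2 / 5 * r), t ∉ Set.Icc 0 (Real.sqrt n))
    (hab : Disjoint (Set.Ioo a (a + 2 / 5 * r)) (Set.Ioo b (b + 2 / 5 * r))) :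
    volume.real (square n ∩ Metric.ball p (2 * r)) ≤ 54 / 5 * r ^ 2 := by
  -- Two boxes inside the disc and outside the square: `1.4² + 1.42² < 4` and `1.8² + 0.87² < 4`.
  -- Their total area `1.832 r²` brings `4π r²` below `10.8 r²`.
  set R₁ := {z : Plane | z i ∈ Set.Ioo a (a + 2 / 5 * r) ∧
    z (1 - i) ∈ Set.Ioo (p (1 - i) - 71 / 50 * r) (p (1 - i) + 71 / 50 * r)} with hR₁
  set R₂ := {z : Plane | z i ∈ Set.Ioo b (b + 2 / 5 * r) ∧
    z (1 - i) ∈ Set.Ioo (p (1 - i) - 87 / 100 * r) (p (1 - i) + 87 / 100 * r)} with hR₂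
  have hd : Disjoint R₁ R₂ := by
    rw [Set.disjoint_left] at hab ⊢
    exact fun z h1 h2 => hab h1.1 h2.1
  have hd' : Disjoint (square n ∩ Metric.ball p (2 * r)) (R₁ ∪ R₂) := by
    rw [Set.disjoint_left]
    rintro z ⟨hz, -⟩ (h | h)
    · exact ha' _ h.1 (hz i)
    · exact hb' _ h.1 (hz i)
  have hsub : (square n ∩ Metric.ball p (2 * r)) ∪ (R₁ ∪ R₂) ⊆ Metric.ball p (2 * r) := by
    refine Set.union_subset Set.inter_subset_right (Set.union_subset ?_ ?_)
    · rintro z ⟨h1, h2⟩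
      have h3 := abs_le.1 (ha _ h1)
      rw [Metric.mem_ball, ← sq_lt_sq₀ dist_nonneg (by linarith), dist_sq_coords' i]
      nlinarith [h2.1, h2.2]
    · rintro z ⟨h1, h2⟩
      have h3 := abs_le.1 (hb _ h1)
      rw [Metric.mem_ball, ← sq_lt_sq₀ dist_nonneg (by linarith), dist_sq_coords' i]
      nlinarith [h2.1, h2.2]
  have h1 : volume.real R₁ = (2 / 5 * r) * (71 / 25 * r) := by
    rw [hR₁, volume_real_box _ _ _ _ _ (by linarith) (by linarith)]; ring
  have h2 : volume.real R₂ = (2 / 5 * r) * (87 / 50 * r) := by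
    rw [hR₂, volume_real_box _ _ _ _ _ (by linarith) (by linarith)]; ring
  have hfin : volume (Metric.ball p (2 * r)) ≠ ⊤ := measure_ball_lt_top.ne
  have hle := measureReal_mono hsub hfin
  have hf := fun S (hS : S ⊆ (square n ∩ Metric.ball p (2 * r)) ∪ (R₁ ∪ R₂)) =>
    measure_ne_top_of_subset (hS.trans hsub) hfin
  rw [measureReal_union hd' ((measurableSet_box i _ _ _ _).union (measurableSet_box i _ _ _ _))
      (hf _ Set.subset_union_left) (hf _ Set.subset_union_right),
    measureReal_union hd (measurableSet_box i _ _ _ _)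
      (hf _ (Set.subset_union_left.trans Set.subset_union_right))
      (hf _ (Set.subset_union_right.trans Set.subset_union_right)),
    h1, h2, volume_real_ball p (by linarith)] at hle
  nlinarith [Real.pi_lt_d2, mul_le_mul_of_nonneg_right Real.pi_lt_d2.le (sq_nonneg r)]

theorem volume_real_square_inter_ball_le_of_near {n : ℕ} {r : ℝ} (hr : 0 < r) (p : Plane)
    (i : Fin 2) (h : p i ≤ r ∨ Real.sqrt n - r ≤ p i) :
    volume.real (square n ∩ Metric.ball p (2 * r)) ≤ 54 / 5 * r ^ 2 := by
  rcases h with h | h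
  · apply volume_real_square_inter_ball_le hr p i (p i - 7 / 5 * r) (p i - 9 / 5 * r)
    · rintro t ⟨h1, h2⟩; rw [abs_le]; constructor <;> linarith
    · rintro t ⟨h1, h2⟩; rw [abs_le]; constructor <;> linarith
    · rintro t ⟨h1, h2⟩ h3; linarith [h3.1]
    · rintro t ⟨h1, h2⟩ h3; linarith [h3.1]
    · rw [Set.disjoint_left]
      rintro t ⟨h1, h2⟩ ⟨h3, h4⟩
      linarith
  · apply volume_real_square_inter_ball_le hr p i (p i + r) (p i + 7 / 5 * r)
    · rintro t ⟨h1, h2⟩; rw [abs_le]; constructor <;> linarith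
    · rintro t ⟨h1, h2⟩; rw [abs_le]; constructor <;> linarith
    · rintro t ⟨h1, h2⟩ h3; linarith [h3.2]
    · rintro t ⟨h1, h2⟩ h3; linarith [h3.2]
    · rw [Set.disjoint_left]
      rintro t ⟨h1, h2⟩ ⟨h3, h4⟩
      linarith

/-! ### Graph distance, deep vertices and the short-range estimate. -/

section Graph

variable {n : ℕ} {r : ℝ} {x : Fin n → Plane}

/-- The first alternative is needed for the empty walk, where the strict inequality fails. -/
theorem dist_lt_of_walk (u v : Fin n) (p : (geomGraph r x).Walk u v) :
    u = v ∨ dist (x u) (x v) < r * p.length := by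
  induction p with
  | nil => left; rfl
  | @cons a b c h p ih =>
    right
    have h1 : dist (x a) (x b) < r := h.2
    rw [SimpleGraph.Walk.length_cons]
    push_cast
    rcases ih with rfl | ih
    · have : 0 ≤ r := dist_nonneg.trans h1.le
      nlinarith [mul_nonneg this (Nat.cast_nonneg (α := ℝ) p.length)]
    · linarith [dist_triangle (x a) (x b) (x c)]

theorem dist_lt_of_edist_le {u v : Fin n} {m : ℕ} (hr : 0 < r) (hm : 0 < m)
    (h : (geomGraph r x).edist u v ≤ m) : dist (x u) (x v) < m * r := by
  obtain ⟨p, hp⟩ := SimpleGraph.exists_walk_of_edist_ne_top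
    (ne_top_of_le_ne_top (ENat.natCast_ne_top m) h)
  rw [← hp, Nat.cast_le] at h
  have h' : (p.length : ℝ) ≤ m := by exact_mod_cast h
  rcases dist_lt_of_walk u v p with rfl | h1
  · rw [dist_self]; positivity
  · nlinarith

theorem ofReal_dist_le_edist (hr : 0 < r) (u v : Fin n) :
    ENNReal.ofReal (dist (x u) (x v)) ≤
      ENNReal.ofReal r * ((geomGraph r x).edist u v : ℝ≥0∞) := by
  by_cases h : (geomGraph r x).edist u v = ⊤
  · rw [h, ENat.toENNReal_top, ENNReal.mul_top (by simpa using hr)]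
    exact le_top
  · obtain ⟨p, hp⟩ := SimpleGraph.exists_walk_of_edist_ne_top h
    rw [← hp, ENat.toENNReal_coe, ← ENNReal.ofReal_natCast, ← ENNReal.ofReal_mul hr.le]
    apply ENNReal.ofReal_le_ofReal
    rcases dist_lt_of_walk u v p with rfl | h1
    · rw [dist_self]; positivity
    · exact h1.le

theorem edist_le_one_of_dist_lt {u v : Fin n} (h : dist (x u) (x v) < r) :
    (geomGraph r x).edist u v ≤ 1 := by
  by_cases huv : u = v
  · subst huv; simp
  · have hadj : (geomGraph r x).Adj u v := ⟨huv, h⟩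
    exact (SimpleGraph.edist_eq_one_iff_adj.2 hadj).le

/-- The number of points in each region of a family indexed by pairs of vertices is close to the
area of the region. -/
def Concentrated (x : Fin n → Plane) (R : Plane → Plane → Set Plane) : Prop :=
  ∀ i j, |pointCount x (R (x i) (x j)) - volume.real (square n ∩ R (x i) (x j))| ≤
    deviation (Real.log n) (volume.real (square n ∩ R (x i) (x j)))

/-- Vertices at graph distance at most `2` lie in the disc of radius `2r`. Near a side this disc has
area at most `10.8 r²` in the square, and the deviation is too small to bring the count up to `11
r²`. -/
theorem IsDeep.mem_interior (hn : 1 ≤ Real.log n) (hr : 1000 * Real.log n ≤ r)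
    (hc : Concentrated x fun p _ => Metric.ball p (2 * r)) {v : Fin n}
    (hv : IsDeep (geomGraph r x) r v) (i : Fin 2) :
    r < x v i ∧ x v i < Real.sqrt n - r := by
  set l := Real.log n
  have hr0 : 0 < r := by linarith
  by_contra hcon
  have hnear : x v i ≤ r ∨ Real.sqrt n - r ≤ x v i := by
    rw [not_and_or, not_lt, not_lt] at hcon; exact hcon
  have hvol := volume_real_square_inter_ball_le_of_near (n := n) hr0 (x v) i hnear
  have hcv := hc v v
  simp only at hcv
  set a := volume.real (square n ∩ Metric.ball (x v) (2 * r))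
  have h1 : (({w | (geomGraph r x).edist v w ≤ 2}.ncard : ℕ) : ℝ) ≤
      pointCount x (Metric.ball (x v) (2 * r)) := by
    rw [pointCount_eq_ncard, Nat.cast_le]
    refine Set.ncard_le_ncard (fun w hw => ?_) (Set.toFinite _)
    have := dist_lt_of_edist_le (m := 2) hr0 two_pos hw
    rw [dist_comm] at this
    exact this
  have h2 : 11 * r ^ 2 ≤ _ := hv
  have h3 : Real.sqrt (3 * a * l) ≤ 1 / 100 * r ^ 2 := by
    apply Real.sqrt_le_iff.2 ⟨by positivity, ?_⟩
    have e1 : a * l ≤ 54 / 5 * r ^ 2 * (r / 1000) :=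
      mul_le_mul hvol (by linarith) (by linarith) (by positivity)
    have e2 : r ^ 2 * r * 1000 ≤ r ^ 2 * r * r :=
      mul_le_mul_of_nonneg_left (by linarith) (by positivity)
    nlinarith
  have h4 := (abs_le.1 hcv).2
  rw [deviation] at h4
  nlinarith

/-- A vertex lies in its own disc but is not its own neighbour, so neighbour counts and point counts
may disagree at the two centres. -/
theorem abs_ncard_sub_pointCount_le {S : Set (Fin n)} {R : Set Plane} (i j : Fin n)
    (h : ∀ k, k ≠ i → k ≠ j → (k ∈ S ↔ x k ∈ R)) :
    |(S.ncard : ℝ) - pointCount x R| ≤ 2 := by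
  classical
  have : (S.ncard : ℝ) = pointCount id S := (pointCount_eq_ncard id S).symm
  rw [this, pointCount, pointCount]
  refine abs_sum_sub_sum_le_two (i := i) (j := j) (fun k hi hj => ?_) fun k => ?_
  · by_cases hk : k ∈ S
    · simp [hk, (h k hi hj).1 hk]
    · simp [hk, mt (h k hi hj).2 hk]
  · by_cases h1 : id k ∈ S <;> by_cases h2 : x k ∈ R <;>
      simp only [h1, h2, Set.indicator_of_mem, Set.indicator_of_notMem, not_false_eq_true] <;>
      norm_num

theorem ball_subset_square {p : Plane} (h : ∀ i, r < p i ∧ p i < Real.sqrt n - r) :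
    Metric.ball p r ⊆ square n := by
  intro z hz i
  have h1 : |z i - p i| < r := by
    have : |z i - p i| ≤ dist z p := by
      rw [dist_eq_norm]; simpa using PiLp.norm_apply_le (z - p) i
    exact this.trans_lt hz
  have := abs_lt.1 h1
  constructor <;> linarith [h i]

/-- Both regions lie in the disc around `v`, so only `v` has to be away from the sides for them to
have their full areas. Graph distance at most `1` or equal to `2` tells on which side of `r` the
distance lies. -/
theorem abs_shortDist_sub_dist_le (hn : 1 ≤ Real.log n) (hr : Real.log n ^ 2 ≤ r)
    (hlune : Concentrated x fun p q => Metric.ball p r \ Metric.ball q r)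
    (hlens : Concentrated x fun p q => Metric.ball p r ∩ Metric.ball q r) {v w : Fin n}
    (hv : ∀ i, r < x v i ∧ x v i < Real.sqrt n - r) (hvw : (geomGraph r x).edist v w ≤ 2) :
    |shortDist (geomGraph r x) r v w - dist (x v) (x w)| ≤ 100 * Real.sqrt (Real.log n) := by
  have hr0 : 0 < r := by nlinarith
  have hball := ball_subset_square hv
  rw [shortDist]
  split_ifs with h
  · have hd : dist (x v) (x w) < r := by
      simpa using dist_lt_of_edist_le (m := 1) hr0 one_pos (by simpa using h)
    refine abs_luneAreaInv_min_sub_le hn hr dist_nonneg hd.le (Nat.cast_nonneg _) ?_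
    have h1 := hlune v w
    simp only at h1
    rw [Set.inter_eq_right.2 (Set.sdiff_subset.trans hball), volume_ball_sdiff_ball] at h1
    have h2 := abs_ncard_sub_pointCount_le (x := x)
      (S := (geomGraph r x).neighborSet v \ (geomGraph r x).neighborSet w)
      (R := Metric.ball (x v) r \ Metric.ball (x w) r) v w fun k hkv hkw => by
        simp [geomGraph, hkv.symm, hkw.symm, dist_comm]
    exact (abs_sub_le _ _ _).trans (by linarith)
  · have hd : r ≤ dist (x v) (x w) := not_lt.1 fun h1 => h (edist_le_one_of_dist_lt h1)
    have hd2 := dist_lt_of_edist_le (m := 2) hr0 two_pos hvw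
    refine abs_luneAreaInv_max_sub_le hn hr hd (by exact_mod_cast hd2.le) (Nat.cast_nonneg _) ?_
    have h1 := hlens v w
    simp only at h1
    rw [Set.inter_eq_right.2 (Set.inter_subset_left.trans hball),
      volume_ball_inter_ball _ _ hr0] at h1
    have h2 := abs_ncard_sub_pointCount_le (x := x)
      (S := (geomGraph r x).neighborSet v ∩ (geomGraph r x).neighborSet w)
      (R := Metric.ball (x v) r ∩ Metric.ball (x w) r) v w fun k hkv hkw => by
        simp [geomGraph, hkv.symm, hkw.symm, dist_comm]
    exact (abs_sub_le _ _ _).trans (by linarith)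

end Graph

/-! ### Chains of gaps and greedy walks in a random set of cells. -/

/-- From the cell `i` one can make `k` hops of nominal length `m` so that the cells of `O` are
missed in every hop by the amount of the shortfall, and the shortfalls, each at most `M`, add up
to at least `D`. -/
def GapChain (O : Set ℕ) (m M : ℕ) : ℕ → ℕ → ℕ → Prop
  | 0, _, D => D = 0
  | k + 1, i, D => ∃ g ≤ M, (∀ c ∈ Finset.Ioc (i + m - g) (i + m), c ∉ O) ∧
      GapChain O m M k (i + m - g) (D - g)

theorem GapChain.anti {O : Set ℕ} {m M : ℕ} {k i D D' : ℕ} (h : GapChain O m M k i D)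
    (hD : D' ≤ D) : GapChain O m M k i D' := by
  induction k generalizing i D D' with
  | zero =>
    have : D = 0 := h
    exact show D' = 0 by omega
  | succ k ih =>
    obtain ⟨g, hg, h1, h2⟩ := h
    exact ⟨g, hg, h1, ih h2 (by omega)⟩

theorem gapChain_of_seq {O : Set ℕ} {m M : ℕ} (k : ℕ) (j : ℕ → ℕ)
    (h : ∀ a < k, j a + m ≤ j (a + 1) + M ∧ j (a + 1) ≤ j a + m ∧
      ∀ c, j (a + 1) < c → c ≤ j a + m → c ∉ O) :
    GapChain O m M k (j 0) (j 0 + k * m - j k) := by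
  induction k generalizing j with
  | zero => exact show _ = 0 by simp
  | succ k ih =>
    obtain ⟨h1, h2, h3⟩ := h 0 (Nat.succ_pos k)
    simp only [zero_add] at h1 h2 h3
    have ih' := ih (fun a => j (a + 1)) fun a ha => h (a + 1) (by omega)
    have e : j 0 + m - (j 0 + m - j 1) = j 1 := by omega
    refine ⟨j 0 + m - j 1, by omega, fun c hc => ?_, ?_⟩
    · rw [Finset.mem_Ioc, e] at hc
      exact h3 c hc.1 hc.2
    · rw [e]
      refine ih'.anti (le_of_eq ?_)
      rw [Nat.succ_mul]
      simp only [zero_add]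
      omega

theorem measurableSet_gapChain {Ω : Type*} [MeasurableSpace Ω] {O : Ω → Set ℕ}
    (hO : ∀ c, MeasurableSet {ω | c ∈ O ω}) (m M k i D : ℕ) :
    MeasurableSet {ω | GapChain (O ω) m M k i D} := by
  induction k generalizing i D with
  | zero => exact MeasurableSet.const (D = 0)
  | succ k ih =>
    have : {ω | GapChain (O ω) m M (k + 1) i D} = ⋃ g ∈ Finset.range (M + 1),
        ((⋂ c ∈ Finset.Ioc (i + m - g) (i + m), {ω | c ∈ O ω}ᶜ) ∩
          {ω | GapChain (O ω) m M k (i + m - g) (D - g)}) := by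
      ext ω
      simp [GapChain, and_left_comm]
    rw [this]
    exact Finset.measurableSet_biUnion _ fun g _ =>
      (Finset.measurableSet_biInter _ fun c _ => (hO c).compl).inter (ih _ _)

theorem sum_exp_neg_le (M : ℕ) : ∑ g ∈ Finset.range (M + 1), Real.exp (-(g : ℝ)) ≤ Real.exp 1 := by
  have h1 : Real.exp (-1) ≤ 1 / 2 := by
    rw [Real.exp_neg, inv_eq_one_div]
    exact one_div_le_one_div_of_le two_pos (by linarith [Real.add_one_le_exp (1 : ℝ)])
  calc _ ≤ ∑ g ∈ Finset.range (M + 1), (1 / 2 : ℝ) ^ g := by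
        refine Finset.sum_le_sum fun g _ => ?_
        rw [show -(g : ℝ) = g * (-1) by ring, Real.exp_nat_mul]
        exact pow_le_pow_left₀ (Real.exp_pos _).le h1 g
    _ ≤ 2 := sum_geometric_two_le _
    _ ≤ _ := by linarith [Real.add_one_le_exp (1 : ℝ)]

/-- If a random set misses every finite set `T` with probability at most `exp (-2 |T|)`, then long
chains of gaps are exponentially unlikely. -/
theorem measureReal_gapChain_le {Ω : Type*} [MeasurableSpace Ω] {P : Measure Ω} [IsFiniteMeasure P]
    {O : Ω → Set ℕ} (hP : ∀ T : Finset ℕ, P.real {ω | ∀ c ∈ T, c ∉ O ω} ≤ Real.exp (-2 * T.card))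
    {m M : ℕ} (hM : 2 * M ≤ m) (k i D : ℕ) (T : Finset ℕ) (hT : ∀ c ∈ T, c + M ≤ i + m) :
    P.real {ω | (∀ c ∈ T, c ∉ O ω) ∧ GapChain (O ω) m M k i D} ≤
      Real.exp (k - D - 2 * T.card) := by
  induction k generalizing i D T with
  | zero =>
    by_cases hD : D = 0
    · subst hD
      refine (measureReal_mono fun ω hω => hω.1).trans ((hP T).trans (le_of_eq ?_))
      congr 1; push_cast; ring
    · have : {ω | (∀ c ∈ T, c ∉ O ω) ∧ GapChain (O ω) m M 0 i D} = ∅ := by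
        ext ω; simp [GapChain, hD]
      rw [this, measureReal_empty]
      exact (Real.exp_pos _).le
  | succ k ih =>
    have hsub : {ω | (∀ c ∈ T, c ∉ O ω) ∧ GapChain (O ω) m M (k + 1) i D} ⊆
        ⋃ g ∈ Finset.range (M + 1), {ω | (∀ c ∈ T ∪ Finset.Ioc (i + m - g) (i + m), c ∉ O ω) ∧
          GapChain (O ω) m M k (i + m - g) (D - g)} := by
      rintro ω ⟨h1, g, hg, h2, h3⟩
      simp only [Set.mem_iUnion, Finset.mem_range]
      refine ⟨g, by omega, fun c hc => ?_, h3⟩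
      rcases Finset.mem_union.1 hc with hc | hc
      · exact h1 c hc
      · exact h2 c hc
    refine (measureReal_mono hsub (measure_ne_top _ _)).trans ((measureReal_biUnion_finset_le _ _).trans ?_)
    -- A gap of `g` new empty cells costs `exp(-2g)`: one factor `exp(-g)` pays for the shortfall,
    -- the other makes the sum over `g` at most `e`, the cost of one hop. The new cells are disjoint
    -- from `T`, which ends at `i + m - M`; `2M ≤ m` preserves this for the next hop.
    calc _ ≤ ∑ g ∈ Finset.range (M + 1), Real.exp (k - D - 2 * T.card) * Real.exp (-(g : ℝ)) := by
          refine Finset.sum_le_sum fun g hg => ?_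
          have hg : g ≤ M := by rw [Finset.mem_range] at hg; omega
          have hcard : (T ∪ Finset.Ioc (i + m - g) (i + m)).card = T.card + g := by
            rw [Finset.card_union_of_disjoint, Nat.card_Ioc]
            · omega
            · rw [Finset.disjoint_left]
              intro c hc hc'
              have := hT c hc
              rw [Finset.mem_Ioc] at hc'
              omega
          refine (ih (i + m - g) (D - g) _ ?_).trans ?_
          · intro c hc
            rcases Finset.mem_union.1 hc with hc | hc
            · have := hT c hc; omega
            · rw [Finset.mem_Ioc] at hc; omega
          · rw [hcard, ← Real.exp_add, Real.exp_le_exp]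
            have : (D : ℝ) ≤ ((D - g : ℕ) : ℝ) + g := by
              rw [← Nat.cast_add, Nat.cast_le]; omega
            push_cast
            linarith
      _ = Real.exp (k - D - 2 * T.card) * ∑ g ∈ Finset.range (M + 1), Real.exp (-(g : ℝ)) := by
          rw [Finset.mul_sum]
      _ ≤ Real.exp (k - D - 2 * T.card) * Real.exp 1 :=
          mul_le_mul_of_nonneg_left (sum_exp_neg_le M) (Real.exp_pos _).le
      _ = _ := by rw [← Real.exp_add]; congr 1; push_cast; ring

/-- A set of cells is unfavourable when a greedy walk of hops of length at most `m` may get stuck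
or loses too much. -/
def IsUnfavourable (O : Set ℕ) (m M N L : ℕ) : Prop :=
  (∃ i < N, ∀ c ∈ Finset.Icc (i + m - M) (i + m), c ∉ O) ∨ ∃ k < N, GapChain O m M k 0 (k + L)

theorem measurableSet_isUnfavourable {Ω : Type*} [MeasurableSpace Ω] {O : Ω → Set ℕ}
    (hO : ∀ c, MeasurableSet {ω | c ∈ O ω}) (m M N L : ℕ) :
    MeasurableSet {ω | IsUnfavourable (O ω) m M N L} := by
  have : {ω | IsUnfavourable (O ω) m M N L} =
      (⋃ i ∈ Finset.range N, ⋂ c ∈ Finset.Icc (i + m - M) (i + m), {ω | c ∈ O ω}ᶜ) ∪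
        ⋃ k ∈ Finset.range N, {ω | GapChain (O ω) m M k 0 (k + L)} := by
    ext ω; simp [IsUnfavourable]
  rw [this]
  exact (Finset.measurableSet_biUnion _ fun i _ =>
    Finset.measurableSet_biInter _ fun c _ => (hO c).compl).union
      (Finset.measurableSet_biUnion _ fun k _ => measurableSet_gapChain hO _ _ _ _ _)

/-- Getting stuck requires `M + 1` empty cells in a row, and `2(M + 1) ≥ m`. A chain of `k` hops
that loses `k + L` cells has probability at most `exp(k - (k + L))`. -/
theorem measureReal_isUnfavourable_le {Ω : Type*} [MeasurableSpace Ω] {P : Measure Ω}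
    [IsFiniteMeasure P] {O : Ω → Set ℕ}
    (hP : ∀ T : Finset ℕ, P.real {ω | ∀ c ∈ T, c ∉ O ω} ≤ Real.exp (-2 * T.card))
    {m M : ℕ} (hM : 2 * M ≤ m) (hm : m ≤ 2 * M + 1) (N L : ℕ) :
    P.real {ω | IsUnfavourable (O ω) m M N L} ≤ N * (Real.exp (-m) + Real.exp (-L)) := by
  have hsub : {ω | IsUnfavourable (O ω) m M N L} ⊆
      (⋃ i ∈ Finset.range N, {ω | ∀ c ∈ Finset.Icc (i + m - M) (i + m), c ∉ O ω}) ∪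
        ⋃ k ∈ Finset.range N, {ω | GapChain (O ω) m M k 0 (k + L)} := by
    intro ω hω
    simpa [IsUnfavourable] using hω
  refine (measureReal_mono hsub (measure_ne_top _ _)).trans ((measureReal_union_le _ _).trans ?_)
  rw [mul_add]
  refine add_le_add ?_ ?_
  · refine (measureReal_biUnion_finset_le _ _).trans
      ((Finset.sum_le_card_nsmul _ _ (Real.exp (-m)) fun i _ => ?_).trans_eq (by simp))
    refine (hP _).trans (Real.exp_le_exp.2 ?_)
    rw [Nat.card_Icc]
    have : (m : ℝ) ≤ 2 * ((i + m + 1 - (i + m - M) : ℕ) : ℝ) := by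
      have : m ≤ 2 * (i + m + 1 - (i + m - M)) := by omega
      exact_mod_cast this
    linarith
  · refine (measureReal_biUnion_finset_le _ _).trans
      ((Finset.sum_le_card_nsmul _ _ (Real.exp (-L)) fun k _ => ?_).trans_eq (by simp))
    have := measureReal_gapChain_le hP hM k 0 (k + L) ∅ (by simp)
    simp only [Finset.notMem_empty, false_imp_iff, implies_true, true_and, Finset.card_empty] at this
    refine this.trans (Real.exp_le_exp.2 ?_)
    push_cast
    linarith

/-- The greedy walk through a set of cells that is not unfavourable. -/
theorem exists_greedy_walk {O : Set ℕ} {m M N L J : ℕ} (hM : M < m) (hJ : J < N)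
    (h : ¬ IsUnfavourable O m M N L) :
    ∃ (k : ℕ) (j : ℕ → ℕ), j 0 = 0 ∧ J < j k + m ∧ ∀ a < k, j a + m ≤ J ∧
      j a + m ≤ j (a + 1) + M ∧ j (a + 1) ≤ j a + m ∧ j (a + 1) ∈ O ∧ a * m < j a + a + L := by
  classical
  rw [IsUnfavourable, not_or] at h
  obtain ⟨h1, h2⟩ := h
  push Not at h1 h2
  have hstep : ∀ i, ∃ i', i + m ≤ J → i + m ≤ i' + M ∧ i' ≤ i + m ∧ i' ∈ O ∧
      ∀ c, i' < c → c ≤ i + m → c ∉ O := by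
    intro i
    by_cases hi : i + m ≤ J
    · obtain ⟨c, hc, hcO⟩ := h1 i (by omega)
      rw [Finset.mem_Icc] at hc
      set P : ℕ → Prop := fun c => c ≤ i + m ∧ c ∈ O
      have hP : P c := ⟨hc.2, hcO⟩
      -- Greedy choice: since it takes the last occupied cell in reach, all cells of the shortfall
      -- are empty.
      have hs : P (Nat.findGreatest P (i + m)) := Nat.findGreatest_spec hc.2 hP
      refine ⟨Nat.findGreatest P (i + m), fun _ => ⟨?_, hs.1, hs.2, fun d hd hd' hdO => ?_⟩⟩
      · have := Nat.le_findGreatest hc.2 hP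
        omega
      · exact Nat.findGreatest_is_greatest hd hd' ⟨hd', hdO⟩
    · exact ⟨0, fun h => absurd h hi⟩
  choose nxt hnxt using hstep
  set j : ℕ → ℕ := fun a => nxt^[a] 0 with hj
  have hjs : ∀ a, j (a + 1) = nxt (j a) := fun a => Function.iterate_succ_apply' nxt a 0
  have hex : ∃ k, J < j k + m := by
    by_contra hcon
    push Not at hcon
    -- As `M < m`, every hop advances, so the walk cannot stay below `J` for ever.
    have : ∀ a, a ≤ j a := by
      intro a
      induction a with
      | zero => exact Nat.zero_le _
      | succ a ih =>
        have := (hnxt (j a) (hcon a)).1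
        rw [← hjs] at this
        omega
    have h3 := this (J + 1)
    have h4 := hcon (J + 1)
    omega
  refine ⟨Nat.find hex, j, rfl, Nat.find_spec hex, ?_⟩
  have hlt : ∀ a < Nat.find hex, j a + m ≤ J := fun a ha => not_lt.1 (Nat.find_min hex ha)
  have hgrow : ∀ a ≤ Nat.find hex, a ≤ j a := by
    intro a ha
    induction a with
    | zero => exact Nat.zero_le _
    | succ a ih =>
      have h3 := (hnxt (j a) (hlt a (by omega))).1
      have h4 := ih (by omega)
      rw [← hjs] at h3
      omega
  intro a ha
  have h3 := hnxt (j a) (hlt a ha)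
  rw [← hjs] at h3
  refine ⟨hlt a ha, h3.1, h3.2.1, h3.2.2.1, ?_⟩
  have h5 := gapChain_of_seq (O := O) (m := m) (M := M) a j fun b hb => by
    have := hnxt (j b) (hlt b (by omega))
    rw [← hjs] at this
    exact ⟨this.1, this.2.1, this.2.2.2⟩
  have h6 := hgrow a ha.le
  have h7 := hlt a ha
  by_contra hcon
  exact h2 a (by omega) (h5.anti (show a + L ≤ _ by
    have : j 0 = 0 := rfl
    omega))

/-! ### Coordinates along a segment, and half-strips inside the square. -/

/-- The coordinate of `z` along the line from `p` to `q`. -/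
noncomputable def along (p q z : Plane) : ℝ :=
  ((z 0 - p 0) * (q 0 - p 0) + (z 1 - p 1) * (q 1 - p 1)) / dist p q

/-- The coordinate of `z` across the line from `p` to `q`. -/
noncomputable def across (p q z : Plane) : ℝ :=
  ((z 1 - p 1) * (q 0 - p 0) - (z 0 - p 0) * (q 1 - p 1)) / dist p q

theorem dist_sq_eq_along_across {p q : Plane} (hpq : 0 < dist p q) (y z : Plane) :
    dist y z ^ 2 = (along p q y - along p q z) ^ 2 + (across p q y - across p q z) ^ 2 := by
  have h := dist_sq_coords p q
  rw [dist_sq_coords, along, along, across, across, ← sub_div, ← sub_div, div_pow, div_pow,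
    ← add_div, eq_div_iff (by positivity), h]
  ring

theorem along_left (p q : Plane) : along p q p = 0 := by simp [along]

theorem across_left (p q : Plane) : across p q p = 0 := by simp [across]

theorem along_right {p q : Plane} (hpq : 0 < dist p q) : along p q q = dist p q := by
  have h := dist_sq_coords p q
  rw [along, div_eq_iff hpq.ne', ← sq (dist p q), h]
  ring

theorem across_right (p q : Plane) : across p q q = 0 := by
  rw [across, mul_comm, sub_self, zero_div]

theorem coords_eq_along_across {p q : Plane} (hpq : 0 < dist p q) (z : Plane) :
    z 0 = p 0 + along p q z * ((q 0 - p 0) / dist p q) -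
      across p q z * ((q 1 - p 1) / dist p q) ∧
    z 1 = p 1 + along p q z * ((q 1 - p 1) / dist p q) +
      across p q z * ((q 0 - p 0) / dist p q) := by
  have h := dist_sq_coords p q
  rw [along, across]
  constructor
  · field_simp
    rw [h]; ring
  · field_simp
    rw [h]; ring

theorem measurePreserving_along_across {p q : Plane} (hpq : 0 < dist p q) :
    MeasurePreserving (fun z => (along p q z, across p q z)) volume volume := by
  set a := (q 0 - p 0) / dist p q with ha
  set b := (q 1 - p 1) / dist p q with hb
  have hab : a ^ 2 + b ^ 2 = 1 := by
    rw [ha, hb, div_pow, div_pow, ← add_div, div_eq_one_iff_eq (by positivity), dist_sq_coords]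
    ring
  set f : Plane →ₗᵢ[ℝ] Plane :=
    { toFun := fun z => !₂[z 0 * a + z 1 * b, z 1 * a - z 0 * b]
      map_add' := fun y z => by
        ext i; fin_cases i <;> simp <;> ring
      map_smul' := fun c z => by
        ext i; fin_cases i <;> simp <;> ring
      norm_map' := fun z => by
        rw [EuclideanSpace.norm_eq, EuclideanSpace.norm_eq]
        congr 1
        simp only [Fin.sum_univ_two, Real.norm_eq_abs, sq_abs]
        show (z 0 * a + z 1 * b) ^ 2 + (z 1 * a - z 0 * b) ^ 2 = z 0 ^ 2 + z 1 ^ 2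
        have : (z 0 * a + z 1 * b) ^ 2 + (z 1 * a - z 0 * b) ^ 2 =
          (z 0 ^ 2 + z 1 ^ 2) * (a ^ 2 + b ^ 2) := by ring
        rw [this, hab, mul_one] } with hf
  have h1 := (f.toLinearIsometryEquiv rfl).measurePreserving
  have h2 := measurePreserving_coords.comp (h1.comp (measurePreserving_sub_right volume p))
  convert h2 using 1
  ext z
  · show along p q z = (z 0 - p 0) * a + (z 1 - p 1) * b
    rw [along, ha, hb]; ring
  · show across p q z = (z 1 - p 1) * a - (z 0 - p 0) * b
    rw [across, ha, hb]; ring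

/-- In the dominant coordinate the lateral shift goes back towards `p` and is at most the advance `s
|a|`. In the other coordinate it goes in the direction of travel by at most `h`, which the margin at
`q` allows. So `p` itself may lie on the boundary. -/
theorem half_strip_subset_aux {N h D a b s y p₀ p₁ : ℝ} (hab : a ^ 2 + b ^ 2 = 1)
    (hba : b ^ 2 ≤ a ^ 2) (hh : 0 ≤ h) (hs : h ≤ s) (hsD : s ≤ D) (hy : |y| ≤ h)
    (hyab : 0 ≤ y * (a * b)) (hp₀ : p₀ ∈ Set.Icc 0 N) (hp₁ : p₁ ∈ Set.Icc 0 N)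
    (hq₀ : p₀ + D * a ∈ Set.Icc h (N - h)) (hq₁ : p₁ + D * b ∈ Set.Icc h (N - h)) :
    p₀ + s * a - y * b ∈ Set.Icc 0 N ∧ p₁ + s * b + y * a ∈ Set.Icc 0 N := by
  obtain ⟨hp₀, hp₀'⟩ := hp₀
  obtain ⟨hp₁, hp₁'⟩ := hp₁
  obtain ⟨hq₀, hq₀'⟩ := hq₀
  obtain ⟨hq₁, hq₁'⟩ := hq₁
  have ha1 : |a| ≤ 1 := abs_le_one_iff_mul_self_le_one.2 (by nlinarith)
  have hya : |y * a| ≤ h := by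
    rw [abs_mul]; nlinarith [abs_nonneg y, abs_nonneg a]
  have hyb : |y * b| ≤ s * |a| := by
    rw [abs_mul]
    exact mul_le_mul (hy.trans hs) (sq_le_sq.1 hba) (abs_nonneg _) (hh.trans hs)
  have hya' := abs_le.1 hya
  have hyb' := abs_le.1 hyb
  have hs0 : 0 ≤ s := hh.trans hs
  constructor
  · rcases lt_trichotomy a 0 with h0 | h0 | h0
    · have e1 : y * b ≤ 0 := by
        by_contra hc
        nlinarith [mul_neg_of_neg_of_pos h0 (not_le.1 hc)]
      rw [abs_of_neg h0] at hyb'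
      constructor <;> nlinarith
    · subst h0
      rw [abs_zero, mul_zero] at hyb'
      constructor <;> linarith
    · have e1 : 0 ≤ y * b := by
        by_contra hc
        nlinarith [mul_neg_of_pos_of_neg h0 (not_le.1 hc)]
      rw [abs_of_pos h0] at hyb'
      constructor <;> nlinarith
  · rcases lt_trichotomy b 0 with h0 | h0 | h0
    · have e1 : y * a ≤ 0 := by
        by_contra hc
        nlinarith [mul_neg_of_neg_of_pos h0 (not_le.1 hc)]
      constructor <;> nlinarith
    · subst h0
      constructor <;> linarith
    · have e1 : 0 ≤ y * a := by
        by_contra hc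
        nlinarith [mul_neg_of_pos_of_neg h0 (not_le.1 hc)]
      constructor <;> nlinarith

/-- One of the two sides of a strip that ends well inside a square lies in the square. -/
theorem exists_half_strip_subset {N h D a b p₀ p₁ : ℝ} (hab : a ^ 2 + b ^ 2 = 1) (hh : 0 ≤ h)
    (hp₀ : p₀ ∈ Set.Icc 0 N) (hp₁ : p₁ ∈ Set.Icc 0 N)
    (hq₀ : p₀ + D * a ∈ Set.Icc h (N - h)) (hq₁ : p₁ + D * b ∈ Set.Icc h (N - h)) :
    ∃ Y : Set ℝ, MeasurableSet Y ∧ volume Y = ENNReal.ofReal h ∧ (∀ y ∈ Y, |y| ≤ h) ∧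
      ∀ s, h ≤ s → s ≤ D → ∀ y ∈ Y,
        p₀ + s * a - y * b ∈ Set.Icc 0 N ∧ p₁ + s * b + y * a ∈ Set.Icc 0 N := by
  have key : ∃ Y : Set ℝ, MeasurableSet Y ∧ volume Y = ENNReal.ofReal h ∧ (∀ y ∈ Y, |y| ≤ h) ∧
      ∀ y ∈ Y, (b ^ 2 ≤ a ^ 2 → 0 ≤ y * (a * b)) ∧ (a ^ 2 ≤ b ^ 2 ∧ a ^ 2 ≠ b ^ 2 →
        0 ≤ -y * (b * a)) := by
    -- Exchanging the coordinates reverses orientation, hence the sign of `y`; the good side depends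
    -- on the dominant coordinate and on the sign of `a b`.
    by_cases hc : (b ^ 2 ≤ a ^ 2 ∧ 0 ≤ a * b) ∨ (¬ b ^ 2 ≤ a ^ 2 ∧ a * b ≤ 0)
    · refine ⟨Set.Icc 0 h, measurableSet_Icc, by simp, fun y hy => ?_, fun y hy => ⟨?_, ?_⟩⟩
      · rw [abs_of_nonneg hy.1]; exact hy.2
      · rintro h1
        rcases hc with hc | hc
        · exact mul_nonneg hy.1 hc.2
        · exact absurd h1 hc.1
      · rintro ⟨h1, h2⟩
        rcases hc with hc | hc
        · exact absurd (le_antisymm h1 hc.1) h2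
        · nlinarith [hy.1, hc.2]
    · refine ⟨Set.Icc (-h) 0, measurableSet_Icc, by simp, fun y hy => ?_, fun y hy => ⟨?_, ?_⟩⟩
      · rw [abs_of_nonpos hy.2]; linarith [hy.1]
      · intro h1
        have : a * b ≤ 0 := by
          by_contra h2; exact hc (Or.inl ⟨h1, (not_le.1 h2).le⟩)
        nlinarith [hy.2]
      · rintro ⟨h1, h2⟩
        have : 0 ≤ a * b := by
          by_contra h3
          exact hc (Or.inr ⟨fun h4 => h2 (le_antisymm h1 h4), (not_le.1 h3).le⟩)
        nlinarith [hy.2]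
  obtain ⟨Y, hYm, hYv, hYh, hY⟩ := key
  refine ⟨Y, hYm, hYv, hYh, fun s hs hsD y hy => ?_⟩
  by_cases hc : b ^ 2 ≤ a ^ 2
  · exact half_strip_subset_aux hab hc hh hs hsD (hYh y hy) ((hY y hy).1 hc) hp₀ hp₁ hq₀ hq₁
  · have := half_strip_subset_aux (a := b) (b := a) (y := -y) (by linarith) (not_le.1 hc).le hh hs
      hsD (by rw [abs_neg]; exact hYh y hy) ((hY y hy).2 ⟨(not_le.1 hc).le, (not_le.1 hc).ne⟩)
      hp₁ hp₀ hq₁ hq₀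
    refine ⟨?_, ?_⟩
    · have h2 := this.2; rwa [neg_mul, ← sub_eq_add_neg] at h2
    · have h1 := this.1; rwa [neg_mul, sub_neg_eq_add] at h1

/-! ### Occupied cells of a strip and the probability that it is unfavourable. -/

/-- The cells of length `l` of the strip of half-width `h` around the line from `p` to `q`. -/
def stripCell (p q : Plane) (h l : ℝ) (c : ℕ) : Set Plane :=
  {z | along p q z ∈ Set.Ico (c * l) ((c + 1) * l) ∧ |across p q z| ≤ h}

/-- Only one half of the strip is known to lie in the square, so each cell is credited with `h l`,
half its area. The half-strip is controlled only from distance `h` on. -/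
theorem volume_real_cells_ge {n : ℕ} {p q : Plane} {h l : ℝ} (hh : 0 < h) (hl : 0 < l)
    (hpq : 0 < dist p q) (hp : p ∈ square n) (hq : ∀ i, q i ∈ Set.Icc h (Real.sqrt n - h))
    (T : Finset ℕ) (hT : ∀ c ∈ T, h ≤ c * l ∧ (c + 1) * l ≤ dist p q) :
    T.card * (h * l) ≤ volume.real (square n ∩ {z | ∃ c ∈ T, z ∈ stripCell p q h l c}) := by
  set a := (q 0 - p 0) / dist p q with ha
  set b := (q 1 - p 1) / dist p q with hb
  have hab : a ^ 2 + b ^ 2 = 1 := by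
    rw [ha, hb, div_pow, div_pow, ← add_div, div_eq_one_iff_eq (by positivity), dist_sq_coords]
    ring
  have hDa : p 0 + dist p q * a = q 0 := by rw [ha]; field_simp; ring
  have hDb : p 1 + dist p q * b = q 1 := by rw [hb]; field_simp; ring
  obtain ⟨Y, hYm, hYv, hYh, hY⟩ := exists_half_strip_subset hab hh.le (hp 0) (hp 1)
    (hDa ▸ hq 0) (hDb ▸ hq 1)
  set U : Set ℝ := ⋃ c ∈ T, Set.Ico ((c : ℝ) * l) ((c + 1) * l) with hU
  have hUm : MeasurableSet U := Finset.measurableSet_biUnion _ fun c _ => measurableSet_Ico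
  have hUv : volume U = ENNReal.ofReal (T.card * l) := by
    rw [hU, measure_biUnion_finset _ fun c _ => measurableSet_Ico]
    · have : ∀ c ∈ T, volume (Set.Ico ((c : ℝ) * l) ((c + 1) * l)) = ENNReal.ofReal l := by
        intro c _
        rw [Real.volume_Ico]; congr 1; ring
      rw [Finset.sum_congr rfl this, Finset.sum_const, nsmul_eq_mul,
        ENNReal.ofReal_mul (Nat.cast_nonneg _), ENNReal.ofReal_natCast]
    · intro c _ d _ hcd
      rw [Function.onFun, Set.disjoint_left]
      rintro t ⟨h1, h2⟩ ⟨h3, h4⟩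
      apply hcd
      have e1 : (c : ℝ) < d + 1 := lt_of_mul_lt_mul_right (h1.trans_lt h4) hl.le
      have e2 : (d : ℝ) < c + 1 := lt_of_mul_lt_mul_right (h3.trans_lt h2) hl.le
      have e3 : c < d + 1 := by exact_mod_cast e1
      have e4 : d < c + 1 := by exact_mod_cast e2
      omega
  have hvol : volume ((fun z => (along p q z, across p q z)) ⁻¹' (U ×ˢ Y)) =
      ENNReal.ofReal (T.card * (h * l)) := by
    rw [(measurePreserving_along_across hpq).measure_preimage (hUm.prod hYm).nullMeasurableSet,
      Measure.volume_eq_prod, Measure.prod_prod, hUv, hYv, ← ENNReal.ofReal_mul (by positivity)]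
    congr 1; ring
  have hsub : (fun z => (along p q z, across p q z)) ⁻¹' (U ×ˢ Y) ⊆
      square n ∩ {z | ∃ c ∈ T, z ∈ stripCell p q h l c} := by
    rintro z ⟨hz1, hz2⟩
    simp only [hU, Set.mem_iUnion] at hz1
    obtain ⟨c, hc, hz1⟩ := hz1
    refine ⟨?_, c, hc, hz1, hYh _ hz2⟩
    obtain ⟨e0, e1⟩ := coords_eq_along_across hpq z
    have := hY (along p q z) ((hT c hc).1.trans hz1.1) (hz1.2.le.trans (hT c hc).2) _ hz2
    rw [← e0, ← e1] at this
    intro i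
    fin_cases i
    · exact this.1
    · exact this.2
  rw [measureReal_def, ← ENNReal.ofReal_le_iff_le_toReal, ← hvol]
  · exact measure_mono hsub
  · exact measure_ne_top_of_subset Set.inter_subset_left (by simp [volume_square])

/-- The cells that count as occupied: those that contain a point other than `x i` and `x j`, and
those that are not wholly in the part of the strip between `p` and `q`. -/
def occupiedCells {ι : Type*} (h l : ℝ) (i j : ι) (p q : Plane) (x : ι → Plane) : Set ℕ :=
  {c | c * l < h ∨ dist p q < (c + 1) * l ∨ ∃ k, k ≠ i ∧ k ≠ j ∧ x k ∈ stripCell p q h l c}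

theorem measurable_along_across : Measurable (fun z : (Plane × Plane) × Plane =>
    (along z.1.1 z.1.2 z.2, across z.1.1 z.1.2 z.2)) := by
  unfold along across
  fun_prop

theorem measurableSet_occupiedCells {n : ℕ} (h l : ℝ) (i j : Fin n) (c : ℕ) :
    MeasurableSet {x : Fin n → Plane | c ∈ occupiedCells h l i j (x i) (x j) x} := by
  have : {x : Fin n → Plane | c ∈ occupiedCells h l i j (x i) (x j) x} =
      {_x | c * l < h} ∪ ({x | dist (x i) (x j) < (c + 1) * l} ∪
        ⋃ k : Fin n, ({_x | k ≠ i} ∩ ({_x | k ≠ j} ∩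
          {x | x k ∈ stripCell (x i) (x j) h l c}))) := by
    ext x; simp [occupiedCells]
  rw [this]
  refine (MeasurableSet.const _).union ((measurableSet_lt ?_ measurable_const).union
    (MeasurableSet.iUnion fun k => (MeasurableSet.const _).inter
      ((MeasurableSet.const _).inter ?_)))
  · fun_prop
  · have hm : Measurable fun x : Fin n → Plane =>
        (along (x i) (x j) (x k), across (x i) (x j) (x k)) :=
      measurable_along_across.comp
        (show Measurable fun x : Fin n → Plane => ((x i, x j), x k) by fun_prop)
    exact (hm.fst measurableSet_Ico).inter (measurableSet_le hm.snd.norm measurable_const)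

theorem measurableSet_stripCell (p q : Plane) (h l : ℝ) (c : ℕ) :
    MeasurableSet (stripCell p q h l c) := by
  have hm : Measurable fun z : Plane => (along p q z, across p q z) :=
    measurable_along_across.comp (show Measurable fun z : Plane => ((p, q), z) by fun_prop)
  exact (hm.fst measurableSet_Ico).inter (measurableSet_le hm.snd.norm measurable_const)

/-- The cells of `T` have area at least `4 |T|` in the square, so each of at least `n - 2 ≥ n/2`
free points misses them with probability at most `exp(-4|T|/n)`. If `T` has a cell that is occupied
by convention, the event is empty. -/
theorem measureReal_avoid_occupiedCells_le {n : ℕ} (hn : 4 ≤ n) {p q : Plane} {h l : ℝ}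
    (hhl : h * l = 4) (hh : 0 < h) (hpq : 0 < dist p q) (hp : p ∈ square n)
    (hq : ∀ i, q i ∈ Set.Icc h (Real.sqrt n - h)) (i j : Fin n) (T : Finset ℕ) :
    (pointsLaw n).real {x | ∀ c ∈ T, c ∉ occupiedCells h l i j p q x} ≤
      Real.exp (-2 * T.card) := by
  classical
  have hl : 0 < l := by
    by_contra hc
    nlinarith [not_lt.1 hc]
  have hnpos : (0 : ℝ) < n := by positivity
  have := isProbabilityMeasure_squareLaw (show n ≠ 0 by omega)
  by_cases hT : ∀ c ∈ T, h ≤ c * l ∧ (c + 1) * l ≤ dist p q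
  swap
  · have : {x : Fin n → Plane | ∀ c ∈ T, c ∉ occupiedCells h l i j p q x} = ∅ := by
      ext x
      simp only [Set.mem_ofPred_eq, Set.mem_empty_iff_false, iff_false]
      intro hx
      apply hT
      intro c hc
      have := hx c hc
      simp only [occupiedCells, Set.mem_ofPred_eq, not_or, not_lt] at this
      exact ⟨this.1, this.2.1⟩
    rw [this, measureReal_empty]
    exact (Real.exp_pos _).le
  set S := {z | ∃ c ∈ T, z ∈ stripCell p q h l c} with hS
  have hSm : MeasurableSet S := by
    have : S = ⋃ c ∈ T, stripCell p q h l c := by ext z; simp [hS]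
    rw [this]
    exact Finset.measurableSet_biUnion _ fun c _ => measurableSet_stripCell _ _ _ _ _
  have hvol := volume_real_cells_ge hh hl hpq hp hq T hT
  have hμ : (squareLaw n).real Sᶜ ≤ Real.exp (-(4 * T.card / n)) := by
    rw [probReal_compl_eq_one_sub hSm, squareLaw_real]
    have h1 : 4 * (T.card : ℝ) / n ≤ volume.real (square n ∩ S) / n := by
      apply div_le_div_of_nonneg_right _ hnpos.le
      rw [hhl] at hvol; linarith
    linarith [Real.add_one_le_exp (-(4 * (T.card : ℝ) / n))]
  have hsub : {x : Fin n → Plane | ∀ c ∈ T, c ∉ occupiedCells h l i j p q x} ⊆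
      Set.univ.pi fun k => if k = i ∨ k = j then Set.univ else Sᶜ := by
    intro x hx k _
    by_cases hk : k = i ∨ k = j
    · simp [hk]
    · simp only [hk, if_false]
      rintro ⟨c, hc, hxc⟩
      rw [not_or] at hk
      exact hx c hc (Or.inr (Or.inr ⟨k, hk.1, hk.2, hxc⟩))
  have hpi : (pointsLaw n).real (Set.univ.pi fun k => if k = i ∨ k = j then Set.univ else Sᶜ) =
      ∏ k : Fin n, (squareLaw n).real (if k = i ∨ k = j then Set.univ else Sᶜ) := by
    rw [pointsLaw, measureReal_def, Measure.pi_pi, ENNReal.toReal_prod]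
    rfl
  have : IsProbabilityMeasure (pointsLaw n) := by unfold pointsLaw; infer_instance
  refine (measureReal_mono hsub).trans ?_
  rw [hpi]
  calc _ ≤ ∏ k : Fin n, Real.exp (-(4 * T.card / n) * if k = i ∨ k = j then 0 else 1) := by
        refine Finset.prod_le_prod (fun k _ => measureReal_nonneg) fun k _ => ?_
        by_cases hk : k = i ∨ k = j
        · simp [hk]
        · simpa only [hk, if_false, mul_one] using hμ
    _ = Real.exp (-(4 * T.card / n) * ∑ k : Fin n, if k = i ∨ k = j then 0 else 1) := by
        rw [← Real.exp_sum, Finset.mul_sum]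
    _ ≤ _ := by
        apply Real.exp_le_exp.2
        have h2 : |∑ k : Fin n, (1 : ℝ) - ∑ k : Fin n, (if k = i ∨ k = j then (0 : ℝ) else 1)| ≤
            2 := by
          refine abs_sum_sub_sum_le_two (i := i) (j := j) (fun k hi hj => by simp [hi, hj])
            fun k => ?_
          split_ifs <;> norm_num
        have h3 := (abs_le.1 h2).2
        simp only [Finset.sum_const, Finset.card_univ, Fintype.card_fin, nsmul_eq_mul,
          mul_one] at h3
        have hn4 : (4 : ℝ) ≤ n := by exact_mod_cast hn
        have h4 : (n : ℝ) / 2 ≤ ∑ k : Fin n, (if k = i ∨ k = j then (0 : ℝ) else 1) := by linarith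
        have h5 := mul_le_mul_of_nonneg_left h4 (show 0 ≤ 4 * (T.card : ℝ) / n by positivity)
        have h6 : 4 * (T.card : ℝ) / n * (n / 2) = 2 * T.card := by field_simp; ring
        linarith

/-- With high probability the strip between two points is favourable for the greedy walk. -/
theorem pointsLaw_unfavourable_le {n : ℕ} (hn : 4 ≤ n) {h l : ℝ} (hhl : h * l = 4) (hh : 0 < h)
    {m M L : ℕ} (hM : 2 * M ≤ m) (hm : m ≤ 2 * M + 1) (hmn : 4 * Real.log n ≤ m)
    (hLn : 4 * Real.log n ≤ L) (i j : Fin n) :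
    pointsLaw n {x | (0 < dist (x i) (x j) ∧ x i ∈ square n ∧
      ∀ k, x j k ∈ Set.Icc h (Real.sqrt n - h)) ∧
        IsUnfavourable (occupiedCells h l i j (x i) (x j) x) m M n L} ≤
      ENNReal.ofReal (2 / (n : ℝ) ^ 3) := by
  have := isProbabilityMeasure_squareLaw (show n ≠ 0 by omega)
  have : IsProbabilityMeasure (pointsLaw n) := by unfold pointsLaw; infer_instance
  have hnpos : (0 : ℝ) < n := by positivity
  refine measure_pi_le_of_forall (μ := squareLaw n) i j
    (B := fun p q x => (0 < dist p q ∧ p ∈ square n ∧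
      ∀ k, q k ∈ Set.Icc h (Real.sqrt n - h)) ∧
        IsUnfavourable (occupiedCells h l i j p q x) m M n L) ?_ ?_ ?_
  · have h1 : MeasurableSet {x : Fin n → Plane | 0 < dist (x i) (x j)} :=
      measurableSet_lt measurable_const (by fun_prop)
    have h2 : MeasurableSet {x : Fin n → Plane | x i ∈ square n} :=
      measurable_pi_apply i (measurableSet_square n)
    have h3 : MeasurableSet {x : Fin n → Plane | ∀ k, x j k ∈ Set.Icc h (Real.sqrt n - h)} := by
      rw [show {x : Fin n → Plane | ∀ k, x j k ∈ Set.Icc h (Real.sqrt n - h)} =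
        ⋂ k, {x : Fin n → Plane | x j k ∈ Set.Icc h (Real.sqrt n - h)} by ext; simp]
      exact MeasurableSet.iInter fun k =>
        (show Measurable fun x : Fin n → Plane => x j k by fun_prop) measurableSet_Icc
    exact (h1.inter (h2.inter h3)).inter (measurableSet_isUnfavourable
      (fun c => measurableSet_occupiedCells h l i j c) m M n L)
  · intro p q x y hxy
    have : occupiedCells h l i j p q x = occupiedCells h l i j p q y := by
      ext c
      simp only [occupiedCells, Set.mem_ofPred_eq]
      refine or_congr Iff.rfl (or_congr Iff.rfl (exists_congr fun k => ?_))
      constructor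
      · rintro ⟨h1, h2, h3⟩; exact ⟨h1, h2, hxy k h1 h2 ▸ h3⟩
      · rintro ⟨h1, h2, h3⟩; exact ⟨h1, h2, (hxy k h1 h2).symm ▸ h3⟩
    rw [this]; exact id
  · intro p q
    by_cases hpq : 0 < dist p q ∧ p ∈ square n ∧ ∀ k, q k ∈ Set.Icc h (Real.sqrt n - h)
    swap
    · simp only [hpq, false_and, Set.ofPred_false, measure_empty, zero_le]
    have h1 := measureReal_isUnfavourable_le (P := pointsLaw n)
      (measureReal_avoid_occupiedCells_le hn hhl hh hpq.1 hpq.2.1 hpq.2.2 i j) hM hm n L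
    have h2 : ∀ t : ℝ, 4 * Real.log n ≤ t → Real.exp (-t) ≤ 1 / (n : ℝ) ^ 4 := by
      intro t ht
      refine (Real.exp_le_exp.2 (neg_le_neg ht)).trans (le_of_eq ?_)
      rw [Real.exp_neg, show 4 * Real.log n = ((4 : ℕ) : ℝ) * Real.log n by norm_num,
        Real.exp_nat_mul, Real.exp_log hnpos, one_div]
    have h3 : (n : ℝ) * (Real.exp (-m) + Real.exp (-L)) ≤ 2 / (n : ℝ) ^ 3 := by
      calc _ ≤ (n : ℝ) * (1 / (n : ℝ) ^ 4 + 1 / (n : ℝ) ^ 4) :=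
            mul_le_mul_of_nonneg_left (add_le_add (h2 _ hmn) (h2 _ hLn)) hnpos.le
        _ = _ := by field_simp; norm_num
    calc _ ≤ pointsLaw n {x | IsUnfavourable (occupiedCells h l i j p q x) m M n L} :=
          measure_mono fun x hx => hx.2
      _ = ENNReal.ofReal ((pointsLaw n).real
            {x | IsUnfavourable (occupiedCells h l i j p q x) m M n L}) :=
          by rw [ofReal_measureReal]
      _ ≤ _ := ENNReal.ofReal_le_ofReal (h1.trans h3)

/-! ### From a favourable strip to a short path. -/

/-- Points in cells that are at most `m` apart are adjacent in the geometric graph. -/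
theorem dist_lt_of_along_across {p q y z : Plane} (hpq : 0 < dist p q) {h l r : ℝ} (hh : 2 ≤ h)
    (hhl : h * l = 4) (hr : h ^ 3 = r) (h1 : |along p q y - along p q z| ≤ r - l)
    (h2 : |across p q y| ≤ h) (h3 : |across p q z| ≤ h) : dist y z < r := by
  have hl : 0 < l := by
    by_contra hc
    nlinarith [not_lt.1 hc]
  have hl2 : l ≤ 2 := by nlinarith
  have hr4 : 4 * h ≤ r := by
    rw [← hr]
    nlinarith [mul_nonneg (show 0 ≤ h by linarith) (show 0 ≤ h ^ 2 - 4 by nlinarith)]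
  rw [← sq_lt_sq₀ dist_nonneg (by linarith), dist_sq_eq_along_across hpq]
  have e1 : (along p q y - along p q z) ^ 2 ≤ (r - l) ^ 2 := sq_le_sq' (by linarith [abs_le.1 h1])
    (abs_le.1 h1).2
  have e2 : (across p q y - across p q z) ^ 2 ≤ (2 * h) ^ 2 := by
    apply sq_le_sq' <;> linarith [(abs_le.1 h2).1, (abs_le.1 h2).2, (abs_le.1 h3).1,
      (abs_le.1 h3).2]
  -- This is the balance of the two losses: shortening by `l` gains `2rl - l² = 8h² - l²` in the
  -- square of the distance, more than the lateral `4h²`.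
  have e3 : r * l = 4 * h ^ 2 := by
    rw [← hr]
    calc h ^ 3 * l = h ^ 2 * (h * l) := by ring
      _ = _ := by rw [hhl]; ring
  nlinarith

/-- The vertex `w` is the last but one of the greedy walk: the last one is adjacent or equal to `v`,
while `w` is still at least `r/2` from `v` along the segment, so its lateral offset lengthens the
remaining distance by at most `h²/r = 1/h`. -/
theorem exists_path {n : ℕ} {x : Fin n → Plane} {u v : Fin n} {h l r : ℝ} (hh : 2 ≤ h)
    (hhl : h * l = 4) (hr : h ^ 3 = r) {m M L : ℕ} (hM : 2 * M ≤ m) (hm1 : (m + 2) * l ≤ r)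
    (hm2 : r < (m + 3) * l) (hm6 : 6 ≤ m) (hD : r ≤ dist (x u) (x v)) (hDn : dist (x u) (x v) < n * l)
    (hfav : ¬ IsUnfavourable (occupiedCells h l u v (x u) (x v) x) m M n L) :
    ∃ (w : Fin n) (a : ℕ), (geomGraph r x).edist w v ≤ 2 ∧ (geomGraph r x).edist u w ≤ a ∧
      r * a + dist (x v) (x w) ≤
        dist (x u) (x v) + (64 * (dist (x u) (x v) / r) + 4 * L + 1) / h := by
  have hl : 0 < l := by
    by_contra hc
    nlinarith [not_lt.1 hc]
  have hr0 : 0 < r := by rw [← hr]; positivity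
  have hpq : 0 < dist (x u) (x v) := hr0.trans_le hD
  set D := dist (x u) (x v)
  set p := x u
  set q := x v
  have hm6' : (6 : ℝ) ≤ m := by exact_mod_cast hm6
  have hfloor : 1 ≤ ⌊D / l⌋₊ := by
    rw [Nat.one_le_floor_iff, le_div_iff₀ hl]
    nlinarith
  set J := ⌊D / l⌋₊ - 1 with hJ
  have hJ1 : ∀ c : ℕ, c ≤ J → (c + 1 : ℝ) * l ≤ D := by
    intro c hc
    rw [← le_div_iff₀ hl]
    refine le_trans ?_ (Nat.floor_le (by positivity))
    have : c + 1 ≤ ⌊D / l⌋₊ := by omega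
    exact_mod_cast this
  have hJ2 : ∀ c : ℕ, J < c → D < (c + 1 : ℝ) * l := by
    intro c hc
    rw [← div_lt_iff₀ hl]
    refine (Nat.lt_floor_add_one _).trans_le ?_
    have : ⌊D / l⌋₊ ≤ c := by omega
    have : (⌊D / l⌋₊ : ℝ) ≤ c := by exact_mod_cast this
    linarith
  have hJn : J < n := by
    have : ⌊D / l⌋₊ < n := by
      rw [Nat.floor_lt (by positivity), div_lt_iff₀ hl]; exact hDn
    omega
  have hMr : (2 * M : ℝ) ≤ m := by exact_mod_cast hM
  obtain ⟨k, j, hj0, hjk, hj⟩ := exists_greedy_walk (by omega) hJn hfav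
  have hjr : ∀ a < k, (j a : ℝ) + m ≤ j (a + 1) + M ∧ (j (a + 1) : ℝ) ≤ j a + m := by
    intro a ha
    obtain ⟨-, h2, h3, -⟩ := hj a ha
    exact ⟨by exact_mod_cast h2, by exact_mod_cast h3⟩
  -- every cell of the walk contains a vertex
  have hcell : ∀ a < k, ∃ w, x w ∈ stripCell p q h l (j (a + 1)) := by
    intro a ha
    obtain ⟨h1, -, h3, h4, -⟩ := hj a ha
    have h2 := (hjr a ha).1
    -- The walk never uses a cell that is occupied by convention: one hop already passes distance
    -- `h`, and no cell up to `J` reaches beyond `q`.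
    rcases h4 with h4 | h4 | ⟨w, -, -, hw⟩
    · exfalso
      have e1 : (m : ℝ) / 2 ≤ j (a + 1) := by linarith [Nat.cast_nonneg (α := ℝ) (j a)]
      have e2 := mul_le_mul_of_nonneg_right e1 hl.le
      nlinarith [mul_nonneg (show 0 ≤ h - 2 by linarith) (show 0 ≤ h + 2 by linarith)]
    · exact absurd (hJ1 (j (a + 1)) (by omega)) (not_le.2 h4)
    · exact ⟨w, hw⟩
  have hadj : ∀ a < k, ∀ y z, y ∈ stripCell p q h l (j a) → z ∈ stripCell p q h l (j (a + 1)) →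
      dist y z < r := by
    intro a ha y z hy hz
    obtain ⟨h2, h3⟩ := hjr a ha
    refine dist_lt_of_along_across hpq hh hhl hr ?_ hy.2 hz.2
    obtain ⟨⟨e1, e2⟩, -⟩ := hy
    obtain ⟨⟨e3, e4⟩, -⟩ := hz
    have e5 : (j (a + 1) : ℝ) * l ≤ (j a + m) * l := mul_le_mul_of_nonneg_right h3 hl.le
    have e6 : (j a : ℝ) * l ≤ j (a + 1) * l :=
      mul_le_mul_of_nonneg_right (by linarith [Nat.cast_nonneg (α := ℝ) M]) hl.le
    have e7 : (m : ℝ) * l + 2 * l ≤ r := by linarith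
    rw [abs_le]
    constructor <;> linarith [mul_pos (show (0 : ℝ) < m by linarith) hl]
  have hwalk : ∀ a ≤ k, ∃ w, x w ∈ stripCell p q h l (j a) ∧ (geomGraph r x).edist u w ≤ a := by
    intro a
    induction a with
    | zero =>
      intro _
      refine ⟨u, ?_, by simp⟩
      rw [hj0]
      refine ⟨?_, ?_⟩
      · show along p q p ∈ _
        rw [along_left]; constructor <;> simp [hl]
      · show |across p q p| ≤ h
        rw [across_left, abs_zero]; linarith
    | succ a ih =>
      intro ha
      obtain ⟨w, hw, hd⟩ := ih (by omega)
      obtain ⟨w', hw'⟩ := hcell a (by omega)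
      refine ⟨w', hw', (SimpleGraph.edist_triangle (v := w)).trans ?_⟩
      push_cast
      exact add_le_add hd (edist_le_one_of_dist_lt (hadj a (by omega) _ _ hw hw'))
  have hk : k ≠ 0 := by
    rintro rfl
    have := hJ2 _ hjk
    rw [hj0] at this
    push_cast at this
    nlinarith
  obtain ⟨a, rfl⟩ := Nat.exists_eq_succ_of_ne_zero hk
  obtain ⟨w, hw, hwd⟩ := hwalk a (by omega)
  obtain ⟨w', hw'⟩ := hcell a (by omega)
  have hww' := edist_le_one_of_dist_lt (hadj a (by omega) _ _ hw hw')
  obtain ⟨g1, g2, g3, -, g5⟩ := hj a (by omega)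
  obtain ⟨f2, f3⟩ := hjr a (by omega)
  have hw'v : dist (x w') q < r := by
    refine dist_lt_of_along_across hpq hh hhl hr ?_ hw'.2 (by rw [across_right]; simp; linarith)
    obtain ⟨⟨e1, e2⟩, -⟩ := hw'
    have e3 := hJ2 _ hjk
    have e4 := hJ1 (j (a + 1)) (by omega)
    rw [along_right hpq, abs_le]
    push_cast at e3
    rw [Nat.succ_eq_add_one] at e3
    have e5 : (j (a + 1) + m + 1 : ℝ) * l = j (a + 1) * l + (m + 2) * l - l := by ring
    constructor
    · show _ ≤ _ - D
      linarith
    · show _ - D ≤ _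
      have : 0 < (m + 1) * l := by positivity
      linarith
  refine ⟨w, a, ?_, hwd, ?_⟩
  · refine (SimpleGraph.edist_triangle (v := w')).trans ?_
    exact (add_le_add hww' (edist_le_one_of_dist_lt hw'v)).trans_eq one_add_one_eq_two
  obtain ⟨⟨e1, e2⟩, e3⟩ := hw
  set s := along p q (x w)
  have hrl : r * l = 4 * h ^ 2 := by
    rw [← hr]
    calc h ^ 3 * l = h ^ 2 * (h * l) := by ring
      _ = _ := by rw [hhl]; ring
  have e4 : r / 2 ≤ D - s := by
    have h4 := hJ1 _ g1
    push_cast at h4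
    have : (j a + m + 1 : ℝ) * l = (j a + 1) * l + (m + 3) * l / 2 + (m - 3) / 2 * l := by ring
    have h5 : 0 ≤ (m - 3 : ℝ) / 2 * l := mul_nonneg (by linarith) hl.le
    linarith
  have hhr : h ^ 2 / r = 1 / h := by rw [← hr]; field_simp
  have e5 : dist q (x w) ≤ D - s + 1 / h := by
    rw [← hhr]
    have : 0 ≤ h ^ 2 / r := by positivity
    rw [← sq_le_sq₀ dist_nonneg (by linarith), dist_sq_eq_along_across hpq, along_right hpq,
      across_right]
    have h6 : r * (h ^ 2 / r) = h ^ 2 := by field_simp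
    have h7 : across p q (x w) ^ 2 ≤ h ^ 2 := sq_le_sq' (abs_le.1 e3).1 (abs_le.1 e3).2
    show (D - s) ^ 2 + (0 - across p q (x w)) ^ 2 ≤ _
    nlinarith
  have g5' : (a : ℝ) * m ≤ j a + a + L := by exact_mod_cast g5.le
  have hja : (a : ℝ) * (m / 2) ≤ j a := by
    have : ∀ b ≤ a, (b : ℝ) * (m / 2) ≤ j b := by
      intro b hb
      induction b with
      | zero => simp
      | succ b ih =>
        have i1 := ih (by omega)
        have i2 := (hjr b (by omega)).1
        push_cast
        linarith
    exact this a le_rfl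
  have hs : (j a : ℝ) * l ≤ s := e1
  have ha : (a : ℝ) ≤ 4 * (D / r) := by
    rw [← mul_div_assoc, le_div_iff₀ hr0]
    have h8 := mul_le_mul_of_nonneg_right hja hl.le
    have h9 : (a : ℝ) * r ≤ a * ((m + 3) * l) :=
      mul_le_mul_of_nonneg_left hm2.le (Nat.cast_nonneg _)
    have h10 : (a : ℝ) * ((m + 3) * l) ≤ 4 * (a * (m / 2) * l) := by
      have : 0 ≤ (a : ℝ) * l * (m - 3) := by
        have := Nat.cast_nonneg (α := ℝ) a
        exact mul_nonneg (mul_nonneg this hl.le) (by linarith)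
      linarith
    linarith
  -- Of the four cells lost per hop, three come from `r < (m + 3) l` and one from the gap bound `a m
  -- ≤ j a + a + L`.
  have e6 : r * a ≤ s + (4 * a + L) * l := by
    have h9 : (a : ℝ) * r ≤ a * ((m + 3) * l) :=
      mul_le_mul_of_nonneg_left hm2.le (Nat.cast_nonneg _)
    have h10 := mul_le_mul_of_nonneg_right g5' hl.le
    linarith
  have hl4 : l = 4 / h := by rw [← hhl]; field_simp
  have e7 : (4 * a + L) * l ≤ (64 * (D / r) + 4 * L) / h := by
    rw [hl4, ← mul_div_assoc]
    apply div_le_div_of_nonneg_right _ (by linarith)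
    linarith
  rw [add_div]
  linarith

/-! ### Assembly: good configurations and their probability. -/

theorem dist_le_of_mem_square {n : ℕ} {p q : Plane} (hp : p ∈ square n) (hq : q ∈ square n) :
    dist p q ≤ 2 * Real.sqrt n := by
  have hs := Real.sqrt_nonneg n
  rw [← sq_le_sq₀ dist_nonneg (by positivity), dist_sq_coords]
  have h : ∀ i, (p i - q i) ^ 2 ≤ Real.sqrt n ^ 2 := fun i =>
    sq_le_sq' (by linarith [(hp i).1, (hq i).2]) (by linarith [(hp i).2, (hq i).1])
  linarith [h 0, h 1, sq_nonneg (Real.sqrt n)]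

/-- The estimate of the distances for a configuration of points with all the properties that hold
with high probability. -/
theorem hybridDist_bounds {n : ℕ} {x : Fin n → Plane} {h l r : ℝ} {m M L : ℕ}
    (hn : 1 ≤ Real.log n) (hrn : 1000 * Real.log n ≤ r) (hrn2 : Real.log n ^ 2 ≤ r) (hh : 2 ≤ h)
    (hhn : h ≤ Real.sqrt n)
    (hhl : h * l = 4) (hr : h ^ 3 = r) (hM : 2 * M ≤ m) (hm1 : (m + 2) * l ≤ r)
    (hm2 : r < (m + 3) * l) (hm6 : 6 ≤ m) (hsq : ∀ k, x k ∈ square n)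
    (hball : Concentrated x fun p _ => Metric.ball p (2 * r))
    (hlune : Concentrated x fun p q => Metric.ball p r \ Metric.ball q r)
    (hlens : Concentrated x fun p q => Metric.ball p r ∩ Metric.ball q r)
    (hfav : ∀ i j, ¬ ((0 < dist (x i) (x j) ∧ x i ∈ square n ∧
      ∀ k, x j k ∈ Set.Icc h (Real.sqrt n - h)) ∧
        IsUnfavourable (occupiedCells h l i j (x i) (x j) x) m M n L))
    (u v : Fin n) (hv : IsDeep (geomGraph r x) r v) :
    ENNReal.ofReal (dist (x u) (x v)) ≤
        hybridDist (geomGraph r x) r (100 * Real.sqrt (Real.log n)) u v ∧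
      hybridDist (geomGraph r x) r (100 * Real.sqrt (Real.log n)) u v ≤
        ENNReal.ofReal (dist (x u) (x v) +
          ((128 * (Real.sqrt n / r) + 4 * L + 1) / h + 200 * Real.sqrt (Real.log n))) := by
  have hr0 : 0 < r := by linarith
  have hint := hv.mem_interior hn hrn hball
  have hshort : ∀ w, (geomGraph r x).edist w v ≤ 2 →
      |shortDist (geomGraph r x) r v w - dist (x v) (x w)| ≤ 100 * Real.sqrt (Real.log n) :=
    fun w hw => abs_shortDist_sub_dist_le hn hrn2 hlune hlens hint
      (by rwa [SimpleGraph.edist_comm])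
  have hlog := Real.sqrt_nonneg (Real.log n)
  constructor
  · refine le_iInf₂ fun w hw => ?_
    have h1 := (abs_le.1 (hshort w hw)).1
    calc _ ≤ ENNReal.ofReal (dist (x u) (x w) + dist (x w) (x v)) :=
          ENNReal.ofReal_le_ofReal (dist_triangle _ _ _)
      _ = ENNReal.ofReal (dist (x u) (x w)) + ENNReal.ofReal (dist (x w) (x v)) :=
          ENNReal.ofReal_add dist_nonneg dist_nonneg
      _ ≤ _ := add_le_add (ofReal_dist_le_edist hr0 u w)
          (ENNReal.ofReal_le_ofReal (by rw [dist_comm]; linarith))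
  · rcases lt_or_ge (dist (x u) (x v)) r with hd | hd
    · have huv : (geomGraph r x).edist u v ≤ 2 :=
        (edist_le_one_of_dist_lt hd).trans one_le_two
      have h1 := (abs_le.1 (hshort u huv)).2
      refine (iInf₂_le u huv).trans ?_
      rw [SimpleGraph.edist_self, ENat.toENNReal_zero, mul_zero, zero_add]
      apply ENNReal.ofReal_le_ofReal
      rw [dist_comm] at h1
      have : 0 ≤ (128 * (Real.sqrt n / r) + 4 * L + 1) / h := by positivity
      linarith
    · have hdn := dist_le_of_mem_square (hsq u) (hsq v)
      have hpos : 0 < dist (x u) (x v) := hr0.trans_le hd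
      have hhr : h ≤ r := by
        rw [← hr]; nlinarith [mul_nonneg (show 0 ≤ h by linarith) (show 0 ≤ h ^ 2 - 1 by nlinarith)]
      have hdn' : dist (x u) (x v) < n * l := by
        have e1 : Real.sqrt n ^ 2 = n := Real.sq_sqrt (Nat.cast_nonneg n)
        have e2 : l = 4 / h := by rw [← hhl]; field_simp
        rw [e2, ← mul_div_assoc, lt_div_iff₀ (by linarith)]
        nlinarith
      have hfav' : ¬ IsUnfavourable (occupiedCells h l u v (x u) (x v) x) m M n L := by
        intro hc
        refine hfav u v ⟨⟨hpos, hsq u, fun k => ?_⟩, hc⟩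
        constructor <;> linarith [hint k]
      obtain ⟨w, a, hwv, huw, hpath⟩ := exists_path hh hhl hr hM hm1 hm2 hm6 hd hdn' hfav'
      have h1 := abs_le.1 (hshort w hwv)
      refine (iInf₂_le w hwv).trans ?_
      calc _ ≤ ENNReal.ofReal r * ((a : ℕ∞) : ℝ≥0∞) + ENNReal.ofReal
            (shortDist (geomGraph r x) r v w + 100 * Real.sqrt (Real.log n)) := by
            gcongr
        _ = ENNReal.ofReal (r * a +
            (shortDist (geomGraph r x) r v w + 100 * Real.sqrt (Real.log n))) := by
            rw [ENat.toENNReal_coe, ← ENNReal.ofReal_natCast, ← ENNReal.ofReal_mul hr0.le,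
              ← ENNReal.ofReal_add (by positivity)
                (by linarith [dist_nonneg (x := x v) (y := x w), h1.1])]
        _ ≤ _ := by
            apply ENNReal.ofReal_le_ofReal
            have e1 : (64 * (dist (x u) (x v) / r) + 4 * L + 1) / h ≤
                (128 * (Real.sqrt n / r) + 4 * L + 1) / h := by
              apply div_le_div_of_nonneg_right _ (by linarith)
              have : dist (x u) (x v) / r ≤ 2 * (Real.sqrt n / r) := by
                rw [← mul_div_assoc]
                exact div_le_div_of_nonneg_right hdn hr0.le
              linarith
            linarith [h1.2]

theorem pointsLaw_exists_le {n : ℕ} (hn : 0 < n) {Q : Fin n → Fin n → (Fin n → Plane) → Prop}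
    (hQ : ∀ i j, pointsLaw n {x | Q i j x} ≤ ENNReal.ofReal (2 / (n : ℝ) ^ 3)) :
    pointsLaw n {x | ∃ i j, Q i j x} ≤ ENNReal.ofReal (2 / n) := by
  have hnpos : (0 : ℝ) < n := by positivity
  have : {x | ∃ i j, Q i j x} = ⋃ i, ⋃ j, {x | Q i j x} := by ext x; simp
  rw [this]
  calc _ ≤ ∑ _i : Fin n, ∑ _j : Fin n, ENNReal.ofReal (2 / (n : ℝ) ^ 3) :=
        (measure_iUnion_fintype_le _ _).trans (Finset.sum_le_sum fun i _ =>
          (measure_iUnion_fintype_le _ _).trans (Finset.sum_le_sum fun j _ => hQ i j))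
    _ = ENNReal.ofReal (2 / n) := by
        simp only [Finset.sum_const, Finset.card_univ, Fintype.card_fin, nsmul_eq_mul]
        rw [← ENNReal.ofReal_natCast, ← ENNReal.ofReal_mul hnpos.le,
          ← ENNReal.ofReal_mul hnpos.le]
        congr 1
        field_simp

theorem pointsLaw_not_concentrated_le {n : ℕ} (hn : 1 ≤ Real.log n)
    {R : Set ((Plane × Plane) × Plane)} (hR : MeasurableSet R) :
    pointsLaw n {x | ¬ Concentrated x fun p q => Prod.mk (p, q) ⁻¹' R} ≤
      ENNReal.ofReal (2 / n) := by
  have hn0 : 0 < n := by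
    rcases Nat.eq_zero_or_pos n with rfl | h
    · norm_num at hn
    · exact h
  refine le_trans (measure_mono fun x hx => ?_)
    (pointsLaw_exists_le hn0 fun i j => pointsLaw_deviation_le hn i j hR)
  simp only [Concentrated, Set.mem_ofPred_eq, not_forall, not_le] at hx
  exact hx

theorem pointsLaw_outside_square {n : ℕ} (hn : 0 < n) :
    pointsLaw n {x | ∃ k, x k ∉ square n} = 0 := by
  have := isProbabilityMeasure_squareLaw hn.ne'
  have h0 : squareLaw n (square n)ᶜ = 0 := by
    rw [ProbabilityTheory.cond_apply (measurableSet_square n)]; simp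
  have : {x : Fin n → Plane | ∃ k, x k ∉ square n} =
      ⋃ k, Function.eval k ⁻¹' (square n)ᶜ := by ext x; simp
  rw [this, measure_iUnion_null_iff]
  intro k
  rw [pointsLaw, (measurePreserving_eval (fun _ => squareLaw n) k).measure_preimage
    (measurableSet_square n).compl.nullMeasurableSet, h0]

/-- Four bad events of probability at most `2/n` each, three failures of concentration and one
unfavourable strip, and the null event of a point outside the square. -/
theorem one_sub_le_pointsLaw {n : ℕ} {h l r : ℝ} {m M L : ℕ} (hn4 : 4 ≤ n)
    (hn : 1 ≤ Real.log n) (hrn : 1000 * Real.log n ≤ r) (hrn2 : Real.log n ^ 2 ≤ r) (hh : 2 ≤ h)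
    (hhn : h ≤ Real.sqrt n) (hhl : h * l = 4) (hr : h ^ 3 = r) (hM : 2 * M ≤ m)
    (hM' : m ≤ 2 * M + 1) (hm1 : (m + 2) * l ≤ r) (hm2 : r < (m + 3) * l) (hm6 : 6 ≤ m)
    (hmn : 4 * Real.log n ≤ m) (hLn : 4 * Real.log n ≤ L) {E : ℝ}
    (hE : (128 * (Real.sqrt n / r) + 4 * L + 1) / h + 200 * Real.sqrt (Real.log n) ≤ E) :
    1 - ENNReal.ofReal (8 / n) ≤ pointsLaw n {x : Fin n → Plane |
      ∀ u v : Fin n, IsDeep (geomGraph r x) r v →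
        ENNReal.ofReal (dist (x u) (x v)) ≤
            hybridDist (geomGraph r x) r (100 * Real.sqrt (Real.log n)) u v ∧
          hybridDist (geomGraph r x) r (100 * Real.sqrt (Real.log n)) u v ≤
            ENNReal.ofReal (dist (x u) (x v) + E)} := by
  have hn0 : 0 < n := by omega
  have := isProbabilityMeasure_squareLaw hn0.ne'
  have hprob : IsProbabilityMeasure (pointsLaw n) := by unfold pointsLaw; infer_instance
  have hb := pointsLaw_not_concentrated_le hn (R := {z | z.2 ∈ Metric.ball z.1.1 (2 * r)})
    (measurableSet_lt (f := fun z : (Plane × Plane) × Plane => dist z.2 z.1.1) (by fun_prop)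
      measurable_const)
  have hm₁ : MeasurableSet {z : (Plane × Plane) × Plane | z.2 ∈ Metric.ball z.1.1 r} :=
    measurableSet_lt (f := fun z : (Plane × Plane) × Plane => dist z.2 z.1.1) (by fun_prop)
      measurable_const
  have hm₂ : MeasurableSet {z : (Plane × Plane) × Plane | z.2 ∈ Metric.ball z.1.2 r} :=
    measurableSet_lt (f := fun z : (Plane × Plane) × Plane => dist z.2 z.1.2) (by fun_prop)
      measurable_const
  have hlu := pointsLaw_not_concentrated_le hn (hm₁.diff hm₂)
  have hle := pointsLaw_not_concentrated_le hn (hm₁.inter hm₂)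
  have hf := pointsLaw_exists_le hn0 fun i j =>
    pointsLaw_unfavourable_le hn4 hhl (by linarith) hM hM' hmn hLn i j
  have ho := pointsLaw_outside_square hn0
  set B₁ := {x : Fin n → Plane | ¬ Concentrated x fun p q =>
    Prod.mk (p, q) ⁻¹' {z : (Plane × Plane) × Plane | z.2 ∈ Metric.ball z.1.1 (2 * r)}} with hB₁
  set B₂ := {x : Fin n → Plane | ¬ Concentrated x fun p q => Prod.mk (p, q) ⁻¹'
    ({z : (Plane × Plane) × Plane | z.2 ∈ Metric.ball z.1.1 r} \
      {z | z.2 ∈ Metric.ball z.1.2 r})} with hB₂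
  set B₃ := {x : Fin n → Plane | ¬ Concentrated x fun p q => Prod.mk (p, q) ⁻¹'
    ({z : (Plane × Plane) × Plane | z.2 ∈ Metric.ball z.1.1 r} ∩
      {z | z.2 ∈ Metric.ball z.1.2 r})} with hB₃
  set B₄ := {x : Fin n → Plane | ∃ i j, (0 < dist (x i) (x j) ∧ x i ∈ square n ∧
    ∀ k, x j k ∈ Set.Icc h (Real.sqrt n - h)) ∧
      IsUnfavourable (occupiedCells h l i j (x i) (x j) x) m M n L} with hB₄
  set B₅ := {x : Fin n → Plane | ∃ k, x k ∉ square n} with hB₅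
  rw [tsub_le_iff_right]
  set G := {x : Fin n → Plane | ∀ u v : Fin n, IsDeep (geomGraph r x) r v →
        ENNReal.ofReal (dist (x u) (x v)) ≤
            hybridDist (geomGraph r x) r (100 * Real.sqrt (Real.log n)) u v ∧
          hybridDist (geomGraph r x) r (100 * Real.sqrt (Real.log n)) u v ≤
            ENNReal.ofReal (dist (x u) (x v) + E)}
  calc (1 : ℝ≥0∞) = pointsLaw n Set.univ := measure_univ.symm
    _ ≤ pointsLaw n (G ∪ (B₁ ∪ (B₂ ∪ (B₃ ∪ (B₄ ∪ B₅))))) := measure_mono fun x _ => by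
        by_cases hx : x ∈ B₁ ∪ (B₂ ∪ (B₃ ∪ (B₄ ∪ B₅)))
        · exact Or.inr hx
        · left
          simp only [Set.mem_union, not_or, hB₁, hB₂, hB₃, hB₄, hB₅, Set.mem_ofPred_eq,
            not_not, not_exists] at hx
          obtain ⟨h1, h2, h3, h4, h5⟩ := hx
          intro u v hv
          have := hybridDist_bounds hn hrn hrn2 hh hhn hhl hr hM hm1 hm2 hm6 h5 h1 h2 h3
            (fun i j => h4 i j) u v hv
          exact ⟨this.1, this.2.trans (ENNReal.ofReal_le_ofReal (by linarith))⟩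
    _ ≤ pointsLaw n G + pointsLaw n (B₁ ∪ (B₂ ∪ (B₃ ∪ (B₄ ∪ B₅)))) := measure_union_le _ _
    _ ≤ pointsLaw n G + ENNReal.ofReal (8 / n) := by
        gcongr
        calc _ ≤ pointsLaw n B₁ + (pointsLaw n B₂ + (pointsLaw n B₃ +
              (pointsLaw n B₄ + pointsLaw n B₅))) :=
              (measure_union_le _ _).trans (add_le_add le_rfl ((measure_union_le _ _).trans
                (add_le_add le_rfl ((measure_union_le _ _).trans (add_le_add le_rfl
                  (measure_union_le _ _))))))
          _ ≤ ENNReal.ofReal (2 / n) + (ENNReal.ofReal (2 / n) + (ENNReal.ofReal (2 / n) +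
              (ENNReal.ofReal (2 / n) + 0))) :=
              add_le_add hb (add_le_add hlu (add_le_add hle (add_le_add hf ho.le)))
          _ = _ := by
              have : (0 : ℝ) ≤ 2 / n := by positivity
              rw [add_zero, ← ENNReal.ofReal_add this this,
                ← ENNReal.ofReal_add this (by positivity),
                ← ENNReal.ofReal_add this (by positivity)]
              congr 1; ring

/-! ### Asymptotics and the choice of parameters. -/

theorem eventually_mul_log_le_rpow (c : ℝ) {β : ℝ} (hβ : 0 < β) :
    ∀ᶠ n : ℕ in atTop, c * Real.log n ≤ (n : ℝ) ^ β := by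
  have h := (isLittleO_log_rpow_atTop hβ).comp_tendsto tendsto_natCast_atTop_atTop
  have hc : 0 < 1 / (|c| + 1) := by positivity
  filter_upwards [h.bound hc, eventually_ge_atTop 1] with n hn hn1
  have hn1' : (1 : ℝ) ≤ n := by exact_mod_cast hn1
  have hlog : 0 ≤ Real.log n := Real.log_nonneg hn1'
  simp only [Function.comp_apply, Real.norm_eq_abs] at hn
  rw [abs_of_nonneg hlog, abs_of_nonneg (show 0 ≤ (n : ℝ) ^ β by positivity), one_div, inv_mul_eq_div,
    le_div_iff₀ (by positivity)] at hn
  have := mul_le_mul_of_nonneg_right (show c ≤ |c| + 1 by linarith [le_abs_self c]) hlog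
  linarith

theorem eventually_error_le {α : ℝ} (hα : 0 < α) :
    ∀ᶠ n : ℕ in atTop, (128 * (Real.sqrt n / (n : ℝ) ^ α) + 4 * ⌈4 * Real.log n⌉₊ + 1) /
      (n : ℝ) ^ (α / 3) + 200 * Real.sqrt (Real.log n) ≤ 400 * errorRate α n := by
  have hlog1 : ∀ᶠ n : ℕ in atTop, 1 ≤ Real.log n :=
    (Real.tendsto_log_atTop.comp tendsto_natCast_atTop_atTop).eventually_ge_atTop 1
  have hβ : ∀ᶠ n : ℕ in atTop, α < 3 / 8 →
      1 * Real.log n ≤ (n : ℝ) ^ (1 / 2 - 4 / 3 * α) := by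
    by_cases h : α < 3 / 8
    · filter_upwards [eventually_mul_log_le_rpow 1 (show 0 < 1 / 2 - 4 / 3 * α by linarith)]
        with n hn _ using hn
    · exact Eventually.of_forall fun n h' => absurd h' h
  filter_upwards [hlog1, hβ, eventually_mul_log_le_rpow 21 (show 0 < α / 3 by positivity),
    eventually_ge_atTop 1] with n hn hnβ hnh hn1
  have hn1' : (1 : ℝ) ≤ n := by exact_mod_cast hn1
  have hnpos : (0 : ℝ) < n := by linarith
  set h := (n : ℝ) ^ (α / 3)
  set l := Real.log n
  have hh : 0 < h := by positivity
  have e1 : Real.sqrt n / (n : ℝ) ^ α / h = (n : ℝ) ^ (1 / 2 - 4 / 3 * α) := by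
    rw [Real.sqrt_eq_rpow, ← Real.rpow_sub hnpos, ← Real.rpow_sub hnpos]
    congr 1; ring
  have e2 : (4 * ⌈4 * l⌉₊ + 1) / h ≤ 1 := by
    rw [div_le_one hh]
    have := Nat.ceil_lt_add_one (show 0 ≤ 4 * l by linarith)
    linarith
  have hl1 : 1 ≤ Real.sqrt l := Real.one_le_sqrt.2 hn
  have e3 : Real.sqrt l ≤ l := Real.sqrt_le_iff.2 ⟨by linarith, by nlinarith⟩
  have e4 : (128 * (Real.sqrt n / (n : ℝ) ^ α) + 4 * ⌈4 * l⌉₊ + 1) / h =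
      128 * (Real.sqrt n / (n : ℝ) ^ α / h) + (4 * ⌈4 * l⌉₊ + 1) / h := by ring
  rw [e4, e1, errorRate]
  split_ifs with hc
  · have := hnβ hc
    linarith
  · have : (n : ℝ) ^ (1 / 2 - 4 / 3 * α) ≤ 1 :=
      Real.rpow_le_one_of_one_le_of_nonpos hn1' (by linarith [not_lt.1 hc])
    linarith

theorem mainTheorem2 :
    ∃ C' : ℝ, 0 < C' ∧ ∀ α : ℝ, 0 < α → α < 1 / 2 →
      Tendsto
        (fun n : ℕ => pointsLaw n {x : Fin n → Plane |
          ∀ u v : Fin n, IsDeep (geomGraph ((n : ℝ) ^ α) x) ((n : ℝ) ^ α) v →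
            ENNReal.ofReal (dist (x u) (x v)) ≤
                hybridDist (geomGraph ((n : ℝ) ^ α) x) ((n : ℝ) ^ α)
                  (100 * Real.sqrt (Real.log n)) u v ∧
              hybridDist (geomGraph ((n : ℝ) ^ α) x) ((n : ℝ) ^ α)
                  (100 * Real.sqrt (Real.log n)) u v ≤
                ENNReal.ofReal (dist (x u) (x v) + C' * errorRate α n)})
        atTop (𝓝 1) := by
  refine ⟨400, by norm_num, fun α hα hα2 => ?_⟩
  have hlim : Tendsto (fun n : ℕ => 1 - ENNReal.ofReal (8 / (n : ℝ))) atTop (𝓝 1) := by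
    have h1 : Tendsto (fun n : ℕ => ENNReal.ofReal (8 / (n : ℝ))) atTop (𝓝 0) := by
      rw [← ENNReal.ofReal_zero]
      exact ENNReal.tendsto_ofReal (tendsto_const_div_atTop_nhds_zero_nat 8)
    have h2 := ENNReal.Tendsto.sub (tendsto_const_nhds (x := (1 : ℝ≥0∞)) (f := atTop)) h1
      (Or.inl ENNReal.one_ne_top)
    rwa [tsub_zero] at h2
  refine tendsto_of_tendsto_of_tendsto_of_le_of_le' hlim tendsto_const_nhds ?_ ?_
  swap
  · filter_upwards [eventually_ge_atTop 1] with n hn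
    have := isProbabilityMeasure_squareLaw (show n ≠ 0 by omega)
    have hprob : IsProbabilityMeasure (pointsLaw n) := by unfold pointsLaw; infer_instance
    exact prob_le_one
  have hlog1 : ∀ᶠ n : ℕ in atTop, 1 ≤ Real.log n :=
    (Real.tendsto_log_atTop.comp tendsto_natCast_atTop_atTop).eventually_ge_atTop 1
  filter_upwards [hlog1, eventually_error_le hα, eventually_mul_log_le_rpow 1000 hα,
    eventually_mul_log_le_rpow 1 (show 0 < α / 2 by positivity),
    eventually_mul_log_le_rpow 2 (show 0 < α / 3 by positivity), eventually_ge_atTop 4]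
    with n hn hE hn1000 hn2 hnh hn4
  have hn1' : (1 : ℝ) ≤ n := by exact_mod_cast (show 1 ≤ n by omega)
  have hnpos : (0 : ℝ) < n := by linarith
  set r := (n : ℝ) ^ α
  set h := (n : ℝ) ^ (α / 3)
  set l := Real.log n
  have hr : h ^ 3 = r := by
    rw [← Real.rpow_natCast, ← Real.rpow_mul hnpos.le]; congr 1; push_cast; ring
  have hh : 2 ≤ h := by linarith
  have hrh : 500 * l ≤ r / (4 / h) := by
    rw [le_div_iff₀ (by positivity), ← mul_div_assoc, div_le_iff₀ (by linarith)]
    nlinarith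
  -- The number of whole cells in a length `r`; a hop uses `b - 2` of them, and a shortfall may be
  -- up to half a hop.
  set b := ⌊r / (4 / h)⌋₊ with hb
  have hb1 : (b : ℝ) ≤ r / (4 / h) := Nat.floor_le (by positivity)
  have hb2 : r / (4 / h) < b + 1 := Nat.lt_floor_add_one _
  have hb8 : 8 ≤ b := Nat.le_floor (by push_cast; linarith)
  have hbm : ((b - 2 : ℕ) : ℝ) = b - 2 := by push_cast [show 2 ≤ b by omega]; ring
  refine one_sub_le_pointsLaw (h := h) (l := 4 / h) (r := r) (m := b - 2) (M := (b - 2) / 2)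
    (L := ⌈4 * l⌉₊) hn4 hn hn1000 ?_ hh ?_ ?_ hr (by omega) (by omega) ?_ ?_ (by omega) ?_
    (Nat.le_ceil _) hE
  · have : r = ((n : ℝ) ^ (α / 2)) ^ 2 := by
      show (n : ℝ) ^ α = _
      rw [← Real.rpow_natCast, ← Real.rpow_mul hnpos.le]; congr 1; push_cast; ring
    rw [this]
    exact pow_le_pow_left₀ (by linarith) (by linarith) 2
  · rw [Real.sqrt_eq_rpow]
    exact Real.rpow_le_rpow_of_exponent_le hn1' (by linarith)
  · field_simp
  · rw [hbm, ← le_div_iff₀ (by positivity)]; linarith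
  · rw [hbm, ← div_lt_iff₀ (by positivity)]; linarith
  · rw [hbm]; linarith
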